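/- \textbf{Conventions.} For a finite-dimensional Hilbert space $X\neq 0$ let $\mathrm{Aut}(X)$ be its unitary group, $|X|=\dim X$, and $\|A\|_{HS,X}=\big(\tfrac{1}{|X|}\mathrm{Tr}(A^*A)\big)^{1/2}$, with the distance $d(a,b)=\|a-b\|_{HS,X}$ on $\mathrm{Aut}(X)$. For a finite set $X\ne\emptyset$ let $\mathrm{Aut}(X)$ be its symmetric group, with the normalized Hamming distance $d(\sigma,\tau)=\frac1{|X|}\#\{x\in X:\sigma(x)\neq\tau(x)\}$. A group $G$ is \emph{flexibly $HS$-stable} if for every sequence of maps $\varphi_n\colon G\to\mathrm{Aut}(X_n)$, with $X_n\ne0$ finite-dimensional Hilbert spaces, such that $d(\varphi_n(a)\varphi_n(b),\varphi_n(ab))\to0$ for all $a,b\in G$, there are finite-dimensional Hilbert spaces $Y_n\supseteq X_n$ and homomorphisms $\psi_n\colon G\to\mathrm{Aut}(Y_n)$ such that $|Y_n|/|X_n|\to1$ and $\|\varphi_n(a)-p_n\psi_n(a)p_n\|_{HS,X_n}\to0$ for all $a\in G$, where $p_n$ is the orthogonal projection of $Y_n$ onto $X_n$ and $p_n\psi_n(a)p_n$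 is regarded as an operator on $X_n$. A group $G$ is \emph{flexibly $P$-stable} if for every sequence of maps $\varphi_n\colon G\to\mathrm{Aut}(X_n)$, with $X_n\neq\emptyset$ finite sets, such that $d(\varphi_n(a)\varphi_n(b),\varphi_n(ab))\to0$ for all $a,b\in G$, there are finite sets $Y_n\supseteq X_n$ and homomorphisms $\psi_n\colon G\to\mathrm{Aut}(Y_n)$ such that $|Y_n|/|X_n|\to1$ and $\frac1{|X_n|}\#\{x\in X_n:\varphi_n(a)(x)\ne\psi_n(a)(x)\}\to0$ for all $a\in G$. For a group $H$ let $\Lambda_{HS}(H)$ be the free abelian group on the isomorphism classes of irreducible finite-dimensional unitary representations of $H$, and let $\Lambda_P(H)$ be the free abelian group on the isomorphism classes of transitive actions of $H$ on non-empty finite sets. \textbf{Theorem.} Let $G$ be a finitely generated group, let $i\colon H\to G$ be an injective homomorphism of groups, and let $G*_HG$ be the group double, i.e. the amalgamated free product of two copies of $G$ along the same inclusion $i$. Let $\mathcal C$ be $HS$ or $P$. If $\mathrm{rk}\,\Lambda_{\mathcal C}(H)<\infty$ and $G$ is flexibly $\mathcal C$-stable, then $G*_HG$ is flexibly $\mathcal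 C$-stable. Moreover, if $H$ is finite, then $\mathrm{rk}\,\Lambda_{\mathcal C}(H)<\infty$ for both choices of $\mathcal C$. -/

import Mathlib

open Filter Topology

namespace FlexStab

/-! ### Normalised metrics on finite-dimensional unitary groups and finite symmetric groups -/

section Metrics

/-- The normalised Hilbert-Schmidt norm `‖A‖ = (Tr (A* A) / dim X) ^ (1/2)` of an operator on a
finite-dimensional Hilbert space. -/
noncomputable def hsNorm {X : Type*} [NormedAddCommGroup X] [InnerProductSpace ℂ X]
    [FiniteDimensional ℂ X] (A : X →ₗ[ℂ] X) : ℝ :=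
  Real.sqrt ((LinearMap.trace ℂ X (LinearMap.adjoint A ∘ₗ A)).re / Module.finrank ℂ X)

/-- A unitary operator, seen as a linear map. -/
def unitaryToLin {X : Type*} [NormedAddCommGroup X] [InnerProductSpace ℂ X]
    (a : X ≃ₗᵢ[ℂ] X) : X →ₗ[ℂ] X :=
  a.toLinearEquiv.toLinearMap

/-- The normalised Hilbert-Schmidt distance on the unitary group of `X`. -/
noncomputable def hsDist {X : Type*} [NormedAddCommGroup X] [InnerProductSpace ℂ X]
    [FiniteDimensional ℂ X] (a b : X ≃ₗᵢ[ℂ] X) : ℝ :=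
  hsNorm (unitaryToLin a - unitaryToLin b)

/-- The compression `p b p`, as an operator on `X`, of a unitary operator `b` on `Y`, where `X` is
a subspace of `Y` through the isometric embedding `j` and `p` is the orthogonal projection onto
`X`. -/
noncomputable def compression {X Y : Type*} [NormedAddCommGroup X] [InnerProductSpace ℂ X]
    [FiniteDimensional ℂ X] [NormedAddCommGroup Y] [InnerProductSpace ℂ Y]
    [FiniteDimensional ℂ Y] (j : X →ₗᵢ[ℂ] Y) (b : Y ≃ₗᵢ[ℂ] Y) : X →ₗ[ℂ] X :=
  LinearMap.adjoint j.toLinearMap ∘ₗ unitaryToLin b ∘ₗ j.toLinearMap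

/-- The normalised Hamming distance on the symmetric group of a finite set `X`. -/
noncomputable def hammDist {X : Type*} (σ τ : Equiv.Perm X) : ℝ :=
  (Set.ncard {x : X | σ x ≠ τ x} : ℝ) / Nat.card X

/-- The normalised number of points of `X` at which a permutation `σ` of `X` differs from a
permutation `τ` of a set `Y` that contains `X` through the embedding `j`. -/
noncomputable def hammDistOn {X Y : Type*} (j : X ↪ Y) (σ : Equiv.Perm X) (τ : Equiv.Perm Y) :
    ℝ :=
  (Set.ncard {x : X | j (σ x) ≠ τ (j x)} : ℝ) / Nat.card X

end Metrics

/-! ### Flexible stability -/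

/-- Flexible Hilbert-Schmidt stability: every sequence of asymptotic homomorphisms to unitary
groups of non-zero finite-dimensional Hilbert spaces `X n` is asymptotically the compression of a
sequence of unitary representations on spaces `Y n ⊇ X n` with `dim (Y n) / dim (X n) → 1`. -/
def FlexiblyHSStable (G : Type*) [Group G] : Prop :=
  ∀ (X : ℕ → Type) [∀ n, NormedAddCommGroup (X n)] [∀ n, InnerProductSpace ℂ (X n)]
    [∀ n, FiniteDimensional ℂ (X n)] [∀ n, Nontrivial (X n)]
    (φ : ∀ n, G → (X n ≃ₗᵢ[ℂ] X n)),
    (∀ a b : G, Tendsto (fun n => hsDist (φ n a * φ n b) (φ n (a * b))) atTop (𝓝 0)) →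
    ∃ (Y : ℕ → Type) (_ : ∀ n, NormedAddCommGroup (Y n))
      (_ : ∀ n, InnerProductSpace ℂ (Y n)) (_ : ∀ n, FiniteDimensional ℂ (Y n))
      (j : ∀ n, X n →ₗᵢ[ℂ] Y n) (ψ : ∀ n, G →* (Y n ≃ₗᵢ[ℂ] Y n)),
      (∀ a : G, Tendsto
        (fun n => hsNorm (unitaryToLin (φ n a) - compression (j n) (ψ n a))) atTop (𝓝 0)) ∧
      Tendsto (fun n => (Module.finrank ℂ (Y n) : ℝ) / Module.finrank ℂ (X n)) atTop (𝓝 1)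

/-- Flexible stability in permutations: every sequence of asymptotic homomorphisms to symmetric
groups of non-empty finite sets `X n` is asymptotically given by a sequence of actions on finite
sets `Y n ⊇ X n` with `|Y n| / |X n| → 1`. -/
def FlexiblyPStable (G : Type*) [Group G] : Prop :=
  ∀ (X : ℕ → Type) [∀ n, Finite (X n)] [∀ n, Nonempty (X n)]
    (φ : ∀ n, G → Equiv.Perm (X n)),
    (∀ a b : G, Tendsto (fun n => hammDist (φ n a * φ n b) (φ n (a * b))) atTop (𝓝 0)) →
    ∃ (Y : ℕ → Type) (_ : ∀ n, Finite (Y n))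
      (j : ∀ n, X n ↪ Y n) (ψ : ∀ n, G →* Equiv.Perm (Y n)),
      (∀ a : G, Tendsto (fun n => hammDistOn (j n) (φ n a) (ψ n a)) atTop (𝓝 0)) ∧
      Tendsto (fun n => (Nat.card (Y n) : ℝ) / Nat.card (X n)) atTop (𝓝 1)

/-! ### The group `Λ(H)` for unitary representations -/

/-- A finite-dimensional unitary representation of `H`. -/
structure UnitaryRep (H : Type*) [Group H] where
  space : Type
  [normed : NormedAddCommGroup space]
  [innerProd : InnerProductSpace ℂ space]
  [finDim : FiniteDimensional ℂ space]
  hom : H →* (space ≃ₗᵢ[ℂ] space)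

attribute [instance] UnitaryRep.normed UnitaryRep.innerProd UnitaryRep.finDim

/-- A unitary representation is irreducible if it is non-zero and has no invariant subspaces
except `0` and itself. -/
def UnitaryRep.IsIrred {H : Type*} [Group H] (ρ : UnitaryRep H) : Prop :=
  Nontrivial ρ.space ∧
    ∀ V : Submodule ℂ ρ.space, (∀ h : H, ∀ v ∈ V, ρ.hom h v ∈ V) → V = ⊥ ∨ V = ⊤

/-- Two unitary representations are isomorphic if a unitary operator intertwines them. -/
def UnitaryRep.Iso {H : Type*} [Group H] (ρ σ : UnitaryRep H) : Prop :=
  ∃ u : ρ.space ≃ₗᵢ[ℂ] σ.space, ∀ (h : H) (v : ρ.space), u (ρ.hom h v) = σ.hom h (u v)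

theorem UnitaryRep.iso_equivalence (H : Type*) [Group H] :
    Equivalence (UnitaryRep.Iso (H := H)) where
  refl ρ := ⟨LinearIsometryEquiv.refl ℂ ρ.space, fun _ _ => rfl⟩
  symm := by
    rintro ρ σ ⟨u, hu⟩
    refine ⟨u.symm, fun h v => ?_⟩
    apply u.injective
    simp [hu]
  trans := by
    rintro ρ σ τ ⟨u, hu⟩ ⟨w, hw⟩
    exact ⟨u.trans w, fun h v => by simp [hu, hw]⟩

/-- Isomorphism of irreducible unitary representations. -/
def irrHSSetoid (H : Type*) [Group H] : Setoid {ρ : UnitaryRep H // ρ.IsIrred} where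
  r ρ σ := ρ.1.Iso σ.1
  iseqv :=
    ⟨fun ρ => (UnitaryRep.iso_equivalence H).refl ρ.1,
      fun h => (UnitaryRep.iso_equivalence H).symm h,
      fun h k => (UnitaryRep.iso_equivalence H).trans h k⟩

/-- The set of isomorphism classes of irreducible finite-dimensional unitary representations. -/
def IrrHS (H : Type*) [Group H] := Quotient (irrHSSetoid H)

/-- `Λ(H)` for unitary representations: the free abelian group on the isomorphism classes of
irreducible finite-dimensional unitary representations of `H`. -/
abbrev LambdaHS (H : Type*) [Group H] := IrrHS H →₀ ℤ

/-! ### The group `Λ(H)` for actions on finite sets -/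

/-- An action of `H` on a finite set. -/
structure FinAction (H : Type*) [Group H] where
  carrier : Type
  [finite : Finite carrier]
  hom : H →* Equiv.Perm carrier

attribute [instance] FinAction.finite

/-- Transitivity of an action (on a non-empty finite set). -/
def FinAction.IsTrans {H : Type*} [Group H] (α : FinAction H) : Prop :=
  Nonempty α.carrier ∧ ∀ x y : α.carrier, ∃ h : H, α.hom h x = y

/-- Two actions are isomorphic if there is an equivariant bijection between them. -/
def FinAction.Iso {H : Type*} [Group H] (α β : FinAction H) : Prop :=
  ∃ e : α.carrier ≃ β.carrier, ∀ (h : H) (x : α.carrier), e (α.hom h x) = β.hom h (e x)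

theorem FinAction.iso_equivalence (H : Type*) [Group H] :
    Equivalence (FinAction.Iso (H := H)) where
  refl α := ⟨Equiv.refl α.carrier, fun _ _ => rfl⟩
  symm := by
    rintro α β ⟨e, he⟩
    refine ⟨e.symm, fun h x => ?_⟩
    apply e.injective
    simp [he]
  trans := by
    rintro α β γ ⟨e, he⟩ ⟨f, hf⟩
    exact ⟨e.trans f, fun h x => by simp [he, hf]⟩

/-- Isomorphism of transitive actions on finite sets. -/
def irrPSetoid (H : Type*) [Group H] : Setoid {α : FinAction H // α.IsTrans} where
  r α β := α.1.Iso β.1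
  iseqv :=
    ⟨fun α => (FinAction.iso_equivalence H).refl α.1,
      fun h => (FinAction.iso_equivalence H).symm h,
      fun h k => (FinAction.iso_equivalence H).trans h k⟩

/-- The set of isomorphism classes of transitive actions of `H` on finite sets. -/
def IrrP (H : Type*) [Group H] := Quotient (irrPSetoid H)

/-- `Λ(H)` for actions: the free abelian group on the isomorphism classes of transitive actions
of `H` on finite sets. -/
abbrev LambdaP (H : Type*) [Group H] := IrrP H →₀ ℤ

/-! ### Group doubles -/

/-- The group double `G *_H G` along `i : H → G`: the amalgamated free product of two copies of
`G`, in which the two copies of `i h` are identified for every `h` in `H`. -/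
abbrev GroupDouble {G H : Type*} [Group G] [Group H] (i : H →* G) : Type _ :=
  Monoid.PushoutI (fun _ : Bool => i)

end FlexStab

/-! Restrict an asymptotic homomorphism of the double to the two copies of `G`. Flexible stability
gives genuine `G`-objects `Y₁` and `Y₂` (finite actions or unitary representations), each slightly
larger than `X` and close to the given maps. Over `H` both are close to the same map, so large
`H`-invariant parts of `Y₁` and `Y₂` are isomorphic. An isomorphism of all of `Y₁` with `Y₂` over
`H` would give an action of the double: let the first copy act on `Y₁` and transport the second copy
to `Y₁`. Two obstacles remain.

The multiplicities of `Y₁` and `Y₂` over `H` may differ slightly, and only summands that extend to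
`G` may be added. Finite rank resolves this: differences of restrictions of `G`-objects form a
finitely generated subgroup of `Λ(H)`, so a small difference is cancelled by `G`-objects `A` and `B`
of proportionally small size (`exists_bounded_correction`). The partial isomorphism then extends to
`Y₁ ⊕ A ≅ Y₂ ⊕ B` by cancellation (`exists_equivariant_extension`, `exists_extension_of_mult_eq`).

Closeness is known for each element of `H` separately, while an invariant part needs all of them at
once. With finitely many irreducible objects, finitely many elements of `H` induce every
transformation occurring in a finite-dimensional representation or finite action
(`exists_finset_forall_exists_eq_perm`, `exists_finite_quotient`). For permutations the common part
is then a set of points with good `H`-orbits. For unitaries it comes from averaging the approximate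
intertwiner `j₂ j₁*` and taking the partial isometry of its polar decomposition. -/

namespace FlexStab

/-! ### Cancelling small differences inside a monoid of multiplicity vectors -/

/-- Differences of first components form a subgroup of a finitely generated free abelian group. Fix
a finite basis of it and write each basis vector as a difference of two elements of `D`. The
coordinates of a vector in this basis are bounded linearly by its ℓ¹ norm, so finitely many fixed
elements of `D`, used boundedly often, realise any small difference. -/
theorem exists_bounded_correction {ι : Type*} [Fintype ι] (D : AddSubmonoid ((ι → ℤ) × ℕ)) :
    ∃ C : ℕ, ∀ x ∈ D, ∀ y ∈ D, ∃ a ∈ D, ∃ b ∈ D, x.1 + a.1 = y.1 + b.1 ∧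
      (a.2 : ℤ) ≤ C * ∑ i, |x.1 i - y.1 i| ∧ (b.2 : ℤ) ≤ C * ∑ i, |x.1 i - y.1 i| := by
  classical
  let L : AddSubgroup (ι → ℤ) :=
    { carrier := {v | ∃ x ∈ D, ∃ y ∈ D, v = y.1 - x.1}
      zero_mem' := ⟨0, D.zero_mem, 0, D.zero_mem, by simp⟩
      add_mem' := by
        rintro _ _ ⟨x, hx, y, hy, rfl⟩ ⟨x', hx', y', hy', rfl⟩
        exact ⟨x + x', D.add_mem hx hx', y + y', D.add_mem hy hy', by simp; abel⟩
      neg_mem' := by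
        rintro _ ⟨x, hx, y, hy, rfl⟩
        exact ⟨y, hy, x, hx, by simp⟩ }
  let N : Submodule ℤ (ι → ℤ) := AddSubgroup.toIntSubmodule L
  obtain ⟨n, snf⟩ := N.smithNormalForm (Pi.basisFun ℤ ι)
  have key : ∀ k, ∃ p ∈ D, ∃ q ∈ D, ((snf.bN k : N) : ι → ℤ) = q.1 - p.1 := fun k => (snf.bN k).2
  choose p hp q hq hpq using key
  -- In Smith normal form, a coordinate in the basis of `N` times a nonzero integer is a coordinate
  -- in a basis of the whole lattice, and the latter is linear in the entries of `v`.
  have bound : ∀ k, ∃ C : ℕ, ∀ v : N, |snf.bN.repr v k| ≤ C * ∑ i, |(v : ι → ℤ) i| := by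
    intro k
    refine ⟨∑ i, (snf.bM.repr (Pi.single i 1) (snf.f k)).natAbs, fun v => ?_⟩
    have ha : snf.a k ≠ 0 := by
      intro h
      have h1 := snf.snf k
      rw [h, zero_smul] at h1
      exact snf.bN.ne_zero k (Subtype.ext h1)
    have h1 : snf.bM.repr (v : ι → ℤ) (snf.f k) = snf.bN.repr (snf.a k • v) k :=
      snf.repr_apply_embedding_eq_repr_smul v
    have h2 : (v : ι → ℤ) = ∑ i, (v : ι → ℤ) i • (Pi.single i 1 : ι → ℤ) := by
      ext j
      simp [Finset.sum_apply, Pi.single_apply]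
    have h3 : snf.bM.repr (v : ι → ℤ) (snf.f k)
        = ∑ i, (v : ι → ℤ) i * snf.bM.repr (Pi.single i 1) (snf.f k) := by
      conv_lhs => rw [h2]
      simp only [map_sum, map_smul, Finsupp.coe_finsetSum, Finset.sum_apply, Finsupp.smul_apply,
        smul_eq_mul]
    have h4 : |snf.bN.repr v k| ≤ |snf.a k * snf.bN.repr v k| := by
      rw [abs_mul]
      exact le_mul_of_one_le_left (abs_nonneg _) (Int.one_le_abs ha)
    have h5 : snf.a k * snf.bN.repr v k
        = ∑ i, (v : ι → ℤ) i * snf.bM.repr (Pi.single i 1) (snf.f k) := by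
      rw [← h3, h1, map_smul, Finsupp.smul_apply, smul_eq_mul]
    rw [h5] at h4
    refine h4.trans ((Finset.abs_sum_le_sum_abs _ _).trans ?_)
    push_cast
    rw [Finset.mul_sum]
    refine Finset.sum_le_sum fun i _ => ?_
    rw [abs_mul, mul_comm]
    exact mul_le_mul_of_nonneg_right
      (Finset.single_le_sum (f := fun i => |snf.bM.repr (Pi.single i 1) (snf.f k)|)
        (fun _ _ => abs_nonneg _) (Finset.mem_univ i)) (abs_nonneg _)
  choose C hC using bound
  refine ⟨∑ k, C k * ((p k).2 + (q k).2), fun x hx y hy => ?_⟩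
  let v : N := ⟨y.1 - x.1, x, hx, y, hy, rfl⟩
  set c : Fin n → ℤ := fun k => snf.bN.repr v k with hc
  have hv : y.1 - x.1 = ∑ k, c k • ((q k).1 - (p k).1) := by
    have h1 := congrArg (fun w : N => (w : ι → ℤ)) (snf.bN.sum_repr v)
    simp only [Submodule.coe_sum, Submodule.coe_smul, hpq] at h1
    exact h1.symm
  have hcb : ∀ k, |c k| ≤ C k * ∑ i, |x.1 i - y.1 i| := fun k => by
    simpa [v, abs_sub_comm] using hC k v
  have hsz : ∀ r s : Fin n → (ι → ℤ) × ℕ, (∀ k, (r k).2 + (s k).2 = (p k).2 + (q k).2) →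
      (((∑ k, ((c k).toNat • r k + (-c k).toNat • s k)).2 : ℕ) : ℤ)
        ≤ ((∑ k, C k * ((p k).2 + (q k).2) : ℕ) : ℤ) * ∑ i, |x.1 i - y.1 i| := by
    intro r s hrs
    rw [Prod.snd_sum]
    push_cast
    rw [Finset.sum_mul]
    refine Finset.sum_le_sum fun k _ => ?_
    have h1 : ((r k).2 : ℤ) + (s k).2 = (p k).2 + (q k).2 := by exact_mod_cast hrs k
    simp only [Prod.snd_add, Prod.smul_snd, smul_eq_mul]
    push_cast
    rw [← h1]
    have h2 : ((c k).toNat : ℤ) ≤ |c k| := by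
      rw [Int.toNat_eq_max]; exact max_le (le_abs_self _) (abs_nonneg _)
    have h3 : ((-c k).toNat : ℤ) ≤ |c k| := by
      rw [Int.toNat_eq_max]; exact max_le (neg_le_abs _) (abs_nonneg _)
    calc _ ≤ |c k| * (r k).2 + |c k| * (s k).2 := by gcongr
      _ = |c k| * ((r k).2 + (s k).2) := by ring
      _ ≤ (C k * ∑ i, |x.1 i - y.1 i|) * ((r k).2 + (s k).2) := by
        gcongr; exact hcb k
      _ = _ := by ring
  -- Splitting each `c k` into positive and negative parts keeps both sums inside the monoid, while
  -- their difference is `∑ c k • (q k - p k)`.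
  refine ⟨∑ k, ((c k).toNat • q k + (-c k).toNat • p k), ?_,
    ∑ k, ((c k).toNat • p k + (-c k).toNat • q k), ?_, ?_,
    hsz q p fun k => add_comm _ _, hsz p q fun k => rfl⟩
  · exact D.sum_mem fun k _ => D.add_mem (D.nsmul_mem (hq k) _) (D.nsmul_mem (hp k) _)
  · exact D.sum_mem fun k _ => D.add_mem (D.nsmul_mem (hp k) _) (D.nsmul_mem (hq k) _)
  · have h1 : (∑ k, ((c k).toNat • q k + (-c k).toNat • p k)).1
        - (∑ k, ((c k).toNat • p k + (-c k).toNat • q k)).1 = y.1 - x.1 := by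
      rw [hv, Prod.fst_sum, Prod.fst_sum, ← Finset.sum_sub_distrib]
      refine Finset.sum_congr rfl fun k _ => ?_
      have h2 : c k = ((c k).toNat : ℤ) - ((-c k).toNat : ℤ) := by
        rw [Int.toNat_sub_toNat_neg]
      generalize (c k).toNat = m at h2 ⊢
      generalize (-c k).toNat = m' at h2 ⊢
      rw [h2]
      ext i
      simp
      ring
    rw [← sub_eq_zero] at h1 ⊢
    rw [← h1]
    abel

/-! ### Orbit types of finite actions -/

section Actions

variable {H : Type*} [Group H]

theorem map_inv_mul_apply_eq_iff {V : Type*} (a : H →* Equiv.Perm V) (k h : H) (v : V) :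
    a (k⁻¹ * h) v = v ↔ a h v = a k v := by
  rw [map_mul, map_inv, Equiv.Perm.mul_apply, Equiv.Perm.inv_eq_iff_eq]

/-- The points of an action whose orbit has the isomorphism type `c`. -/
def orbitTypeSet {V : Type*} (a : H →* Equiv.Perm V) (c : IrrP H) : Set V :=
  {v | ∃ x : (Quotient.out c).1.carrier, ∀ h, (Quotient.out c).1.hom h x = x ↔ a h v = v}

/-- The number of points of an action whose orbit has the isomorphism type `c`. -/
noncomputable def orbitTypeCount {V : Type*} (a : H →* Equiv.Perm V) (c : IrrP H) : ℕ :=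
  (orbitTypeSet a c).ncard

/-- The orbit of `v` is a transitive action, and its isomorphism with the chosen representative
sends `v` to a point with the same stabiliser. -/
theorem exists_mem_orbitTypeSet {V : Type} [Finite V] (a : H →* Equiv.Perm V) (v : V) :
    ∃ c, v ∈ orbitTypeSet a c := by
  let O : Set V := {y | ∃ h, a h v = y}
  have hO : ∀ h y, a h y ∈ O ↔ y ∈ O := by
    intro h y
    constructor
    · rintro ⟨k, hk⟩
      exact ⟨h⁻¹ * k, by simp [hk]⟩
    · rintro ⟨k, rfl⟩
      exact ⟨h * k, by simp⟩
  let β : FinAction H :=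
    { carrier := O
      hom :=
        { toFun := fun h => (a h).subtypePerm (hO h)
          map_one' := by ext; simp
          map_mul' := fun h k => by ext y; exact congrArg (fun f : Equiv.Perm V => f y) (map_mul a h k) } }
  have hβ : β.IsTrans := by
    refine ⟨⟨⟨v, 1, by simp⟩⟩, ?_⟩
    rintro ⟨_, h, rfl⟩ ⟨_, k, rfl⟩
    exact ⟨k * h⁻¹, Subtype.ext (by simp [β])⟩
  refine ⟨Quotient.mk (irrPSetoid H) ⟨β, hβ⟩, ?_⟩
  obtain ⟨e, he⟩ := (FinAction.iso_equivalence H).symm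
    (Quotient.mk_out (s := irrPSetoid H) ⟨β, hβ⟩)
  refine ⟨e ⟨v, 1, by simp⟩, fun h => ?_⟩
  refine (Eq.congr_left (he h _).symm).trans (e.injective.eq_iff.trans ?_)
  exact Subtype.ext_iff

/-- Cancellation for finite `H`-sets. The relation `R₀` is the graph of a partial equivariant
injection; take a maximal one containing it. Matched points have equal stabilisers, so equally many
points of each type remain unmatched on both sides, and an unmatched point would allow one more
orbit to be matched. -/
theorem exists_equivariant_extension {V W : Type} [Finite V] [Finite W] (a : H →* Equiv.Perm V)
    (b : H →* Equiv.Perm W) (hab : orbitTypeCount a = orbitTypeCount b) (R₀ : Set (V × W))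
    (hinv : ∀ h, ∀ r ∈ R₀, (a h r.1, b h r.2) ∈ R₀)
    (hinj : ∀ r ∈ R₀, ∀ s ∈ R₀, r.1 = s.1 ↔ r.2 = s.2) :
    ∃ e : V ≃ W, (∀ h v, e (a h v) = b h (e v)) ∧ ∀ r ∈ R₀, e r.1 = r.2 := by
  classical
  let Good : Set (V × W) → Prop := fun R =>
    (∀ h, ∀ r ∈ R, (a h r.1, b h r.2) ∈ R) ∧ ∀ r ∈ R, ∀ s ∈ R, r.1 = s.1 ↔ r.2 = s.2
  obtain ⟨R, hR₀, hmax⟩ := (Set.toFinite {R | Good R}).exists_le_maximal (a := R₀) ⟨hinv, hinj⟩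
  obtain ⟨hRinv, hRinj⟩ : Good R := hmax.prop
  have hstab : ∀ r ∈ R, ∀ h, a h r.1 = r.1 ↔ b h r.2 = r.2 := fun r hr h =>
    hRinj _ (hRinv h r hr) r hr
  have himg : ∀ c, Prod.snd '' {r ∈ R | r.1 ∈ orbitTypeSet a c}
      = orbitTypeSet b c ∩ Prod.snd '' R := by
    intro c
    ext w
    constructor
    · rintro ⟨r, ⟨hr, x, hx⟩, rfl⟩
      exact ⟨⟨x, fun h => (hx h).trans (hstab r hr h)⟩, r, hr, rfl⟩
    · rintro ⟨⟨x, hx⟩, r, hr, rfl⟩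
      exact ⟨r, ⟨hr, x, fun h => (hx h).trans (hstab r hr h).symm⟩, rfl⟩
  have himg' : ∀ c, Prod.fst '' {r ∈ R | r.1 ∈ orbitTypeSet a c}
      = orbitTypeSet a c ∩ Prod.fst '' R := by
    intro c
    ext w
    constructor
    · rintro ⟨r, ⟨hr, hx⟩, rfl⟩
      exact ⟨hx, r, hr, rfl⟩
    · rintro ⟨hx, r, hr, rfl⟩
      exact ⟨r, ⟨hr, hx⟩, rfl⟩
  have hcard : ∀ c, (orbitTypeSet a c ∩ Prod.fst '' R).ncard
      = (orbitTypeSet b c ∩ Prod.snd '' R).ncard := by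
    intro c
    rw [← himg, ← himg', Set.InjOn.ncard_image, Set.InjOn.ncard_image]
    · intro r hr s hs h
      exact Prod.ext ((hRinj r hr.1 s hs.1).2 h) h
    · intro r hr s hs h
      exact Prod.ext h ((hRinj r hr.1 s hs.1).1 h)
  have htot : ∀ v, v ∈ Prod.fst '' R := by
    intro v
    by_contra hv
    obtain ⟨c, hc⟩ := exists_mem_orbitTypeSet a v
    have hlt : (orbitTypeSet b c ∩ Prod.snd '' R).ncard < (orbitTypeSet b c).ncard := by
      rw [← hcard c]
      refine lt_of_lt_of_eq (Set.ncard_lt_ncard ?_) (congrFun hab c)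
      exact ⟨Set.inter_subset_left, fun h => hv (h hc).2⟩
    obtain ⟨w, hw, hwR⟩ : ∃ w ∈ orbitTypeSet b c, w ∉ Prod.snd '' R := by
      by_contra! hcon
      rw [Set.inter_eq_left.2 hcon] at hlt
      exact lt_irrefl _ hlt
    obtain ⟨x, hx⟩ := hc
    obtain ⟨y, hy⟩ := hw
    -- Equal type makes the stabilisers of `v` and `w` conjugate only; moving `w` to `b k w` makes
    -- them equal, so that the two orbits can be matched pointwise.
    obtain ⟨k, hk⟩ := (Quotient.out c).2.2 y x
    have hst : ∀ h h', a h v = a h' v ↔ b h (b k w) = b h' (b k w) := by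
      intro h h'
      have e1 : a h v = a h' v ↔ a (h'⁻¹ * h) v = v := (map_inv_mul_apply_eq_iff a h' h v).symm
      have e2 : b h (b k w) = b h' (b k w) ↔ b (k⁻¹ * (h'⁻¹ * h) * k) w = w := by
        rw [mul_assoc, map_inv_mul_apply_eq_iff, mul_assoc, map_mul, map_inv,
          Equiv.Perm.mul_apply, Equiv.Perm.inv_eq_iff_eq, map_mul,
          Equiv.Perm.mul_apply]
      rw [e1, e2, ← hx, ← hy, ← hk]
      simp only [map_mul, map_inv, Equiv.Perm.coe_mul, Function.comp_apply]
      rw [Equiv.Perm.inv_eq_iff_eq (f := (Quotient.out c).1.hom k)]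
    have hwR' : ∀ h, b h (b k w) ∉ Prod.snd '' R := by
      rintro h ⟨r, hr, h1⟩
      refine hwR ⟨_, hRinv (h * k)⁻¹ r hr, ?_⟩
      simp [h1]
    have hvR' : ∀ h, a h v ∉ Prod.fst '' R := by
      rintro h ⟨r, hr, h1⟩
      refine hv ⟨_, hRinv h⁻¹ r hr, ?_⟩
      simp [h1]
    have hgood : Good (R ∪ Set.range fun h => (a h v, b h (b k w))) := by
      constructor
      · rintro h r (hr | ⟨h', rfl⟩)
        · exact Or.inl (hRinv h r hr)
        · exact Or.inr ⟨h * h', by simp⟩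
      · rintro r (hr | ⟨h, rfl⟩) s (hs | ⟨h', rfl⟩)
        · exact hRinj r hr s hs
        · exact iff_of_false (fun h => hvR' _ ⟨r, hr, h⟩) fun h => hwR' _ ⟨r, hr, h⟩
        · exact iff_of_false (fun h => hvR' _ ⟨s, hs, h.symm⟩)
            fun h => hwR' _ ⟨s, hs, h.symm⟩
        · exact hst h h'
    exact hvR' 1 ⟨_, hmax.le_of_ge hgood Set.subset_union_left (Or.inr ⟨1, rfl⟩), rfl⟩
  have htot' : ∀ w, w ∈ Prod.snd '' R := by
    intro w
    by_contra hw
    obtain ⟨c, hc⟩ := exists_mem_orbitTypeSet b w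
    have h1 := hcard c
    rw [Set.inter_eq_left.2 fun v _ => htot v] at h1
    have h2 : (orbitTypeSet b c ∩ Prod.snd '' R).ncard < (orbitTypeSet b c).ncard :=
      Set.ncard_lt_ncard ⟨Set.inter_subset_left, fun h => hw (h hc).2⟩
    have h3 : (orbitTypeSet a c).ncard = (orbitTypeSet b c).ncard := congrFun hab c
    omega
  choose f hf hf1 using htot
  choose g hg hg2 using htot'
  refine ⟨⟨fun v => (f v).2, fun w => (g w).1, fun v => ?_, fun w => ?_⟩, fun h v => ?_,
    fun r hr => ?_⟩
  · rw [← hf1 v]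
    simp only [hf1 v]
    exact ((hRinj _ (hg _) _ (hf v)).2 (hg2 _)).trans (hf1 v)
  · exact ((hRinj _ (hf _) _ (hg w)).1 (hf1 _)).trans (hg2 w)
  · refine (hRinj _ (hf _) _ (hRinv h _ (hf v))).1 ?_
    simp [hf1]
  · exact (hRinj _ (hf _) _ (hR₀ hr)).1 (hf1 _)

/-- Every stabiliser in a finite action already occurs in one of the finitely many representative
actions. Hence the permutations of those representatives induced by `h` determine its permutation of
any finite action, and they take only finitely many values. -/
theorem exists_finset_forall_exists_eq_perm [Finite (IrrP H)] :
    ∃ F : Finset H, ∀ (V : Type) [Finite V] (a : H →* Equiv.Perm V), ∀ h, ∃ k ∈ F, a h = a k := by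
  classical
  let Φ : H → ∀ c : IrrP H, Equiv.Perm (Quotient.out c).1.carrier :=
    fun h c => (Quotient.out c).1.hom h
  have hfin : (Set.range Φ).Finite := Set.toFinite _
  obtain ⟨F, hF⟩ : ∃ F : Set H, F.Finite ∧ Set.range Φ = Φ '' F := by
    choose f hf using fun y : Set.range Φ => y.2
    have := hfin.to_subtype
    refine ⟨Set.range f, Set.toFinite _, Set.Subset.antisymm (fun y hy => ?_)
      (Set.image_subset_range _ _)⟩
    exact ⟨f ⟨y, hy⟩, ⟨_, rfl⟩, hf ⟨y, hy⟩⟩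
  refine ⟨hF.1.toFinset, fun V _ a h => ?_⟩
  obtain ⟨k, hk, hkh⟩ : Φ h ∈ Φ '' F := hF.2 ▸ Set.mem_range_self h
  refine ⟨k, by simpa using hk, ?_⟩
  ext v
  obtain ⟨c, x, hx⟩ := exists_mem_orbitTypeSet a v
  have h1 := (hx (k⁻¹ * h)).1 (by
    have h2 : (Quotient.out c).1.hom k = (Quotient.out c).1.hom h := congrFun hkh c
    rw [map_inv_mul_apply_eq_iff, h2])
  exact (map_inv_mul_apply_eq_iff a k h v).1 h1

end Actions

/-! ### Sums of actions and stability in permutations of the double -/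

section Actions

variable {H : Type*} [Group H]

/-- The disjoint union of two actions. -/
def sumHom {V W : Type*} (a : H →* Equiv.Perm V) (b : H →* Equiv.Perm W) :
    H →* Equiv.Perm (V ⊕ W) :=
  (Equiv.Perm.sumCongrHom V W).comp (a.prod b)

@[simp] theorem sumHom_inl {V W : Type*} (a : H →* Equiv.Perm V) (b : H →* Equiv.Perm W) (h : H)
    (v : V) : sumHom a b h (Sum.inl v) = Sum.inl (a h v) := rfl

@[simp] theorem sumHom_inr {V W : Type*} (a : H →* Equiv.Perm V) (b : H →* Equiv.Perm W) (h : H)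
    (w : W) : sumHom a b h (Sum.inr w) = Sum.inr (b h w) := rfl

theorem orbitTypeCount_sumHom {V W : Type*} [Finite V] [Finite W] (a : H →* Equiv.Perm V)
    (b : H →* Equiv.Perm W) (c : IrrP H) :
    orbitTypeCount (sumHom a b) c = orbitTypeCount a c + orbitTypeCount b c := by
  have h1 : orbitTypeSet (sumHom a b) c
      = Sum.inl '' orbitTypeSet a c ∪ Sum.inr '' orbitTypeSet b c := by
    ext (v | w) <;> simp [orbitTypeSet]
  rw [orbitTypeCount, h1, Set.ncard_union_eq, Set.ncard_image_of_injective _ Sum.inl_injective,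
    Set.ncard_image_of_injective _ Sum.inr_injective]
  · rfl
  · rw [Set.disjoint_left]
    rintro _ ⟨v, -, rfl⟩ ⟨w, -, h⟩
    cases h

/-- The type of a point depends only on its stabiliser, so the points of `Z` contribute equally to
both counts and only points outside its two images matter. -/
theorem abs_orbitTypeCount_sub_le {X V W : Type*} [Finite X] [Finite V] [Finite W]
    (a : H →* Equiv.Perm V) (b : H →* Equiv.Perm W) (f : X ↪ V) (g : X ↪ W) (Z : Set X)
    (hZ : ∀ z ∈ Z, ∀ h, a h (f z) = f z ↔ b h (g z) = g z) (c : IrrP H) :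
    |(orbitTypeCount a c : ℤ) - orbitTypeCount b c|
      ≤ (Nat.card V - Z.ncard) + (Nat.card W - Z.ncard) := by
  have h1 : (orbitTypeSet a c ∩ f '' Z).ncard = (orbitTypeSet b c ∩ g '' Z).ncard := by
    have e1 : orbitTypeSet a c ∩ f '' Z = f '' {z ∈ Z | f z ∈ orbitTypeSet a c} := by
      ext v
      constructor
      · rintro ⟨h, z, hz, rfl⟩
        exact ⟨z, ⟨hz, h⟩, rfl⟩
      · rintro ⟨z, ⟨hz, h⟩, rfl⟩
        exact ⟨h, z, hz, rfl⟩
    have e2 : orbitTypeSet b c ∩ g '' Z = g '' {z ∈ Z | f z ∈ orbitTypeSet a c} := by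
      ext v
      constructor
      · rintro ⟨⟨x, h⟩, z, hz, rfl⟩
        exact ⟨z, ⟨hz, x, fun k => (h k).trans (hZ z hz k).symm⟩, rfl⟩
      · rintro ⟨z, ⟨hz, x, h⟩, rfl⟩
        exact ⟨⟨x, fun k => (h k).trans (hZ z hz k)⟩, z, hz, rfl⟩
    rw [e1, e2, Set.ncard_image_of_injective _ f.injective,
      Set.ncard_image_of_injective _ g.injective]
  have h2 := Set.ncard_inter_add_ncard_sdiff_eq_ncard (orbitTypeSet a c) (f '' Z)
  have h3 := Set.ncard_inter_add_ncard_sdiff_eq_ncard (orbitTypeSet b c) (g '' Z)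
  have h4 : (orbitTypeSet a c \ f '' Z).ncard ≤ (f '' Z)ᶜ.ncard :=
    Set.ncard_le_ncard fun _ h => h.2
  have h5 : (orbitTypeSet b c \ g '' Z).ncard ≤ (g '' Z)ᶜ.ncard :=
    Set.ncard_le_ncard fun _ h => h.2
  have h6 := Set.ncard_add_ncard_compl (f '' Z)
  have h7 := Set.ncard_add_ncard_compl (g '' Z)
  rw [Set.ncard_image_of_injective _ f.injective] at h6
  rw [Set.ncard_image_of_injective _ g.injective] at h7
  rw [abs_le]
  unfold orbitTypeCount
  omega

/-- The pairs of orbit counts over `H` and cardinalities of finite actions of `G`. -/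
noncomputable def orbitTypeMonoid {G : Type*} [Group G] (i : H →* G) :
    AddSubmonoid ((IrrP H → ℤ) × ℕ) where
  carrier := {p | ∃ A : FinAction G,
    p = (fun c => (orbitTypeCount (A.hom.comp i) c : ℤ), Nat.card A.carrier)}
  zero_mem' := ⟨⟨PEmpty, 1⟩, by
    ext
    · simp [orbitTypeCount, orbitTypeSet, Set.eq_empty_of_isEmpty]
    · simp⟩
  add_mem' := by
    rintro _ _ ⟨A, rfl⟩ ⟨B, rfl⟩
    refine ⟨⟨A.carrier ⊕ B.carrier, sumHom A.hom B.hom⟩, ?_⟩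
    ext c
    · have := orbitTypeCount_sumHom (A.hom.comp i) (B.hom.comp i) c
      simp only [Prod.mk_add_mk, Pi.add_apply]
      exact_mod_cast this.symm
    · simp [Nat.card_sum]

/-- The number of points of `X` at which a permutation of `X` differs from one of `Y ⊇ X`. -/
noncomputable def disagreement {X Y : Type*} (j : X ↪ Y) (σ : Equiv.Perm X) (τ : Equiv.Perm Y) :
    ℕ :=
  Set.ncard {x : X | j (σ x) ≠ τ (j x)}

/-- The quantitative core for permutations: `C` and `F` depend on `i` alone, so every error is
controlled by finitely many disagreements, uniformly in `X`. -/
theorem exists_groupDouble_action {G : Type*} [Group G] (i : H →* G) [Finite (IrrP H)] :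
    ∃ (C : ℕ) (F : Finset H), ∀ (X Y₁ Y₂ : Type) [Finite X] [Finite Y₁] [Finite Y₂]
      (φ : GroupDouble i → Equiv.Perm X) (j₁ : X ↪ Y₁) (j₂ : X ↪ Y₂)
      (ψ₁ : G →* Equiv.Perm Y₁) (ψ₂ : G →* Equiv.Perm Y₂) (n₁ n₂ : G → ℕ) (D : ℕ),
      (∀ g, disagreement j₁ (φ (Monoid.PushoutI.of true g)) (ψ₁ g) = n₁ g) →
      (∀ g, disagreement j₂ (φ (Monoid.PushoutI.of false g)) (ψ₂ g) = n₂ g) →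
      D = ∑ h ∈ F, (n₁ (i h) + n₂ (i h)) →
      ∃ (Y : Type) (_ : Finite Y) (j : X ↪ Y) (Ψ : GroupDouble i →* Equiv.Perm Y),
        (∀ g, disagreement j (φ (Monoid.PushoutI.of true g)) (Ψ (Monoid.PushoutI.of true g))
          ≤ n₁ g) ∧
        (∀ g, disagreement j (φ (Monoid.PushoutI.of false g)) (Ψ (Monoid.PushoutI.of false g))
          ≤ n₂ g + 2 * D) ∧
        (Nat.card Y : ℤ) ≤ Nat.card Y₁ + C * ((Nat.card Y₁ - Nat.card X)
          + (Nat.card Y₂ - Nat.card X) + 2 * D) := by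
  classical
  have := Fintype.ofFinite (IrrP H)
  obtain ⟨C, hC⟩ := exists_bounded_correction (orbitTypeMonoid i)
  obtain ⟨F, hF⟩ := exists_finset_forall_exists_eq_perm (H := H)
  refine ⟨C * Fintype.card (IrrP H), F, fun X Y₁ Y₂ _ _ _ φ j₁ j₂ ψ₁ ψ₂ n₁ n₂ D hn₁ hn₂ hD => ?_⟩
  let a := ψ₁.comp i
  let b := ψ₂.comp i
  -- The points whose two `H`-orbits stay in the images of `X` and correspond to each other there.
  -- On `Z` the correspondence `j₁ x ↦ j₂ x` is equivariant, and `Z` fails only where some element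
  -- of `F` disagrees.
  let Z : Set X := {x | ∀ h, ∃ y, a h (j₁ x) = j₁ y ∧ b h (j₂ x) = j₂ y}
  have hbase : ∀ h, (Monoid.PushoutI.of true (i h) : GroupDouble i)
      = Monoid.PushoutI.of false (i h) := fun h => by
    rw [Monoid.PushoutI.of_apply_eq_base (fun _ : Bool => i),
      Monoid.PushoutI.of_apply_eq_base (fun _ : Bool => i)]
  have hZc : Zᶜ.ncard ≤ D := by
    have hsub : Zᶜ ⊆ ⋃ h ∈ F, ({x | j₁ (φ (Monoid.PushoutI.of true (i h)) x) ≠ ψ₁ (i h) (j₁ x)} ∪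
        {x | j₂ (φ (Monoid.PushoutI.of false (i h)) x) ≠ ψ₂ (i h) (j₂ x)}) := by
      intro x hx
      by_contra hcon
      simp only [Set.mem_iUnion, Set.mem_union, Set.mem_ofPred_eq, not_exists, not_or,
        not_not] at hcon
      refine hx fun h => ?_
      -- Applying this to the disjoint union gives one `k` that represents `h` in both actions at
      -- once.
      obtain ⟨k, hk, hhk⟩ := hF (Y₁ ⊕ Y₂) (sumHom a b) h
      refine ⟨φ (Monoid.PushoutI.of true (i k)) x, ?_, ?_⟩
      · rw [(hcon k hk).1]
        exact Sum.inl_injective (congrArg (fun p : Equiv.Perm _ => p (Sum.inl (j₁ x))) hhk)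
      · rw [hbase, (hcon k hk).2]
        exact Sum.inr_injective (congrArg (fun p : Equiv.Perm _ => p (Sum.inr (j₂ x))) hhk)
    refine (Set.ncard_le_ncard hsub).trans ((Finset.set_ncard_biUnion_le _ _).trans ?_)
    rw [hD]
    refine Finset.sum_le_sum fun h _ => (Set.ncard_union_le _ _).trans ?_
    rw [← hn₁, ← hn₂]
    exact le_rfl
  have hZcard := Set.ncard_add_ncard_compl Z
  have hZinv : ∀ x ∈ Z, ∀ h y, a h (j₁ x) = j₁ y → b h (j₂ x) = j₂ y → y ∈ Z := by
    intro x hx h y h1 h2 k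
    obtain ⟨z, hz1, hz2⟩ := hx (k * h)
    refine ⟨z, ?_, ?_⟩
    · rw [← hz1, ← h1, map_mul, Equiv.Perm.mul_apply]
    · rw [← hz2, ← h2, map_mul, Equiv.Perm.mul_apply]
  have hZst : ∀ z ∈ Z, ∀ h, a h (j₁ z) = j₁ z ↔ b h (j₂ z) = j₂ z := by
    intro z hz h
    obtain ⟨y, h1, h2⟩ := hz h
    rw [h1, h2, j₁.injective.eq_iff, j₂.injective.eq_iff]
  obtain ⟨_, ⟨A, rfl⟩, _, ⟨B, rfl⟩, hAB, hA, -⟩ :=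
    hC _ ⟨⟨Y₁, ψ₁⟩, rfl⟩ _ ⟨⟨Y₂, ψ₂⟩, rfl⟩
  have hcount : orbitTypeCount (sumHom a (A.hom.comp i))
      = orbitTypeCount (sumHom b (B.hom.comp i)) := by
    ext c
    rw [orbitTypeCount_sumHom, orbitTypeCount_sumHom]
    have := congrFun hAB c
    simp only [Pi.add_apply] at this
    exact_mod_cast this
  obtain ⟨e, he, heZ⟩ := exists_equivariant_extension _ _ hcount
    ((fun z => (Sum.inl (j₁ z), Sum.inl (j₂ z))) '' Z) (by
      rintro h _ ⟨z, hz, rfl⟩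
      obtain ⟨y, h1, h2⟩ := hz h
      exact ⟨y, hZinv z hz h y h1 h2, by simp [h1, h2]⟩) (by
      rintro _ ⟨z, hz, rfl⟩ _ ⟨z', hz', rfl⟩
      simp)
  have heZ' : ∀ z ∈ Z, e (Sum.inl (j₁ z)) = Sum.inl (j₂ z) := fun z hz => heZ _ ⟨z, hz, rfl⟩
  let P₁ : G →* Equiv.Perm (Y₁ ⊕ A.carrier) := sumHom ψ₁ A.hom
  let P₂ : G →* Equiv.Perm (Y₁ ⊕ A.carrier) :=
    (e.symm.permCongrHom.toMonoidHom).comp (sumHom ψ₂ B.hom)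
  have hP₂ : ∀ g v, P₂ g v = e.symm (sumHom ψ₂ B.hom g (e v)) := fun g v => rfl
  let Ψ : GroupDouble i →* Equiv.Perm (Y₁ ⊕ A.carrier) :=
    Monoid.PushoutI.lift (fun b => cond b P₁ P₂) (P₁.comp i) (by
      rintro (_ | _)
      · ext h v
        change P₂ (i h) v = P₁ (i h) v
        rw [hP₂, Equiv.symm_apply_eq]
        exact (he h v).symm
      · rfl)
  have hΨ₁ : ∀ g, Ψ (Monoid.PushoutI.of true g) = P₁ g := fun g =>
    Monoid.PushoutI.lift_of (fun b => cond b P₁ P₂) (P₁.comp i) _ g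
  have hΨ₂ : ∀ g, Ψ (Monoid.PushoutI.of false g) = P₂ g := fun g =>
    Monoid.PushoutI.lift_of (fun b => cond b P₁ P₂) (P₁.comp i) _ g
  refine ⟨Y₁ ⊕ A.carrier, inferInstance, j₁.trans Function.Embedding.inl, Ψ, fun g => ?_,
    fun g => ?_, ?_⟩
  · rw [hΨ₁, ← hn₁]
    refine Set.ncard_le_ncard fun x hx h => hx ?_
    simp [P₁, h]
  · rw [hΨ₂, ← hn₂]
    -- The isomorphism `e` is known to match `j₁` with `j₂` only on `Z`. Both `x` and its image
    -- under `φ` must lie there, whence the two terms `D`.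
    have hsub : {x : X | (j₁.trans Function.Embedding.inl) (φ (Monoid.PushoutI.of false g) x)
        ≠ P₂ g ((j₁.trans Function.Embedding.inl) x)} ⊆
        ({x | j₂ (φ (Monoid.PushoutI.of false g) x) ≠ ψ₂ g (j₂ x)} ∪ Zᶜ) ∪
          (φ (Monoid.PushoutI.of false g)) ⁻¹' Zᶜ := by
      intro x hx
      by_contra hcon
      simp only [Set.mem_union, Set.mem_ofPred_eq, Set.mem_compl_iff, Set.mem_preimage, not_or,
        not_not] at hcon
      refine hx ?_
      rw [hP₂, Equiv.eq_symm_apply]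
      simp [heZ' _ hcon.1.2, heZ' _ hcon.2, hcon.1.1]
    have hpre : ((φ (Monoid.PushoutI.of false g)) ⁻¹' Zᶜ).ncard = Zᶜ.ncard := by
      rw [← Equiv.image_symm_eq_preimage]
      exact Set.ncard_image_of_injective _ (Equiv.injective _)
    have h1 := Set.ncard_le_ncard hsub
    have h2 := (Set.ncard_union_le ({x | j₂ (φ (Monoid.PushoutI.of false g) x) ≠ ψ₂ g (j₂ x)} ∪ Zᶜ)
      ((φ (Monoid.PushoutI.of false g)) ⁻¹' Zᶜ))
    have h3 := Set.ncard_union_le {x | j₂ (φ (Monoid.PushoutI.of false g) x) ≠ ψ₂ g (j₂ x)} Zᶜ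
    unfold disagreement
    omega
  · rw [Nat.card_sum]
    push_cast
    have h1 := Finset.sum_le_sum fun c (_ : c ∈ Finset.univ) =>
      abs_orbitTypeCount_sub_le a b j₁ j₂ Z hZst c
    rw [Finset.sum_const, Finset.card_univ, nsmul_eq_mul] at h1
    have h2 : (Nat.card X : ℤ) ≤ Z.ncard + D := by
      rw [← hZcard]; push_cast; gcongr
    have h3 := hA.trans (mul_le_mul_of_nonneg_left h1 (by positivity))
    refine add_le_add_right (h3.trans ?_) _
    rw [← mul_assoc]
    refine mul_le_mul_of_nonneg_left ?_ (by positivity)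
    linarith

theorem disagreement_mul_le {X Y : Type*} [Finite X] (j : X ↪ Y) (σ σ' ρ : Equiv.Perm X)
    (τ τ' : Equiv.Perm Y) : disagreement j ρ (τ * τ') ≤
      Set.ncard {x | (σ * σ') x ≠ ρ x} + (disagreement j σ τ + disagreement j σ' τ') := by
  have hsub : {x | j (ρ x) ≠ (τ * τ') (j x)} ⊆ {x | (σ * σ') x ≠ ρ x} ∪
      (σ' ⁻¹' {x | j (σ x) ≠ τ (j x)} ∪ {x | j (σ' x) ≠ τ' (j x)}) := by
    intro x hx
    by_contra hcon
    simp only [Set.mem_union, Set.mem_ofPred_eq, Set.mem_preimage, not_or, not_not] at hcon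
    refine hx ?_
    rw [← hcon.1, Equiv.Perm.mul_apply, Equiv.Perm.mul_apply, hcon.2.1, hcon.2.2]
  refine (Set.ncard_le_ncard hsub).trans ((Set.ncard_union_le _ _).trans ?_)
  gcongr
  refine (Set.ncard_union_le _ _).trans ?_
  gcongr
  · rw [← Equiv.image_symm_eq_preimage]
    exact (Set.ncard_image_of_injective _ (Equiv.injective _)).le
  · exact le_rfl

theorem groupDouble_induction {G : Type*} [Group G] (i : H →* G) {p : GroupDouble i → Prop}
    (h₁ : ∀ g, p (Monoid.PushoutI.of true g)) (h₂ : ∀ g, p (Monoid.PushoutI.of false g))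
    (hm : ∀ x y, p x → p y → p (x * y)) (x : GroupDouble i) : p x := by
  induction x using Monoid.PushoutI.induction_on with
  | of b g => cases b; exacts [h₂ g, h₁ g]
  | base h => rw [← Monoid.PushoutI.of_apply_eq_base (fun _ : Bool => i) true]; exact h₁ _
  | mul x y hx hy => exact hm x y hx hy

/-- The bounds on the two copies tend to zero after normalisation. Closeness passes to products
because `φ n` is asymptotically multiplicative, and the two copies generate the double. -/
theorem FlexiblyPStable.groupDouble {G : Type*} [Group G] (i : H →* G) [Finite (IrrP H)]
    (hG : FlexiblyPStable G) : FlexiblyPStable (GroupDouble i) := by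
  intro X _ _ φ hφ
  obtain ⟨C, F, hCF⟩ := exists_groupDouble_action i
  have hrestrict : ∀ b : Bool, ∀ x y : G, Tendsto (fun n =>
      hammDist (φ n (Monoid.PushoutI.of b x) * φ n (Monoid.PushoutI.of b y))
        (φ n (Monoid.PushoutI.of b (x * y)))) atTop (𝓝 0) := fun b x y => by
    rw [map_mul]
    exact hφ _ _
  obtain ⟨Y₁, _, j₁, ψ₁, hψ₁, hY₁⟩ := hG X (fun n g => φ n (Monoid.PushoutI.of true g))
    (hrestrict true)
  obtain ⟨Y₂, _, j₂, ψ₂, hψ₂, hY₂⟩ := hG X (fun n g => φ n (Monoid.PushoutI.of false g))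
    (hrestrict false)
  let n₁ : ℕ → G → ℕ := fun n g => disagreement (j₁ n) (φ n (Monoid.PushoutI.of true g)) (ψ₁ n g)
  let n₂ : ℕ → G → ℕ := fun n g => disagreement (j₂ n) (φ n (Monoid.PushoutI.of false g)) (ψ₂ n g)
  let D : ℕ → ℕ := fun n => ∑ h ∈ F, (n₁ n (i h) + n₂ n (i h))
  choose Y hYfin j Ψ h₁ h₂ hcard using fun n => hCF (X n) (Y₁ n) (Y₂ n) (φ n) (j₁ n) (j₂ n) (ψ₁ n)
    (ψ₂ n) (n₁ n) (n₂ n) (D n) (fun _ => rfl) (fun _ => rfl) rfl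
  have hX : ∀ n, (0 : ℝ) < Nat.card (X n) := fun n => by exact_mod_cast Nat.card_pos
  have hn₁ : ∀ g, Tendsto (fun n => (n₁ n g : ℝ) / Nat.card (X n)) atTop (𝓝 0) := hψ₁
  have hn₂ : ∀ g, Tendsto (fun n => (n₂ n g : ℝ) / Nat.card (X n)) atTop (𝓝 0) := hψ₂
  have hD : Tendsto (fun n => (D n : ℝ) / Nat.card (X n)) atTop (𝓝 0) := by
    have h := tendsto_finsetSum F fun h _ => (hn₁ (i h)).add (hn₂ (i h))
    simp only [add_zero, Finset.sum_const_zero] at h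
    refine h.congr fun n => ?_
    simp only [D]
    push_cast
    rw [Finset.sum_div]
    exact Finset.sum_congr rfl fun _ _ => (add_div _ _ _).symm
  refine ⟨Y, hYfin, j, Ψ, fun x => ?_, ?_⟩
  · have hnn : ∀ x, ∀ n, 0 ≤ hammDistOn (j n) (φ n x) (Ψ n x) := fun x n => by
      unfold hammDistOn; positivity
    induction x using groupDouble_induction with
    | h₁ g =>
      refine squeeze_zero (hnn _) (fun n => ?_) (hn₁ g)
      exact div_le_div_of_nonneg_right (by exact_mod_cast h₁ n g) (hX n).le
    | h₂ g =>
      have h := (hn₂ g).add (hD.const_mul 2)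
      simp only [mul_zero, add_zero] at h
      refine squeeze_zero (hnn _) (fun n => ?_) h
      rw [← mul_div_assoc, ← add_div]
      exact div_le_div_of_nonneg_right (by exact_mod_cast h₂ n g) (hX n).le
    | hm x y hx hy =>
      have h := (hφ x y).add (hx.add hy)
      simp only [add_zero] at h
      refine squeeze_zero (hnn _) (fun n => ?_) h
      unfold hammDistOn hammDist
      rw [← add_div, ← add_div, map_mul]
      refine div_le_div_of_nonneg_right ?_ (hX n).le
      exact_mod_cast disagreement_mul_le (j n) (φ n x) (φ n y) (φ n (x * y)) (Ψ n x) (Ψ n y)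
  · have h := hY₁.add (((((hY₁.sub_const 1).add (hY₂.sub_const 1)).add (hD.const_mul 2))).const_mul
      (C : ℝ))
    simp only [sub_self, add_zero, mul_zero] at h
    refine tendsto_of_tendsto_of_tendsto_of_le_of_le tendsto_const_nhds h (fun n => ?_) fun n => ?_
    · change (1 : ℝ) ≤ _
      rw [one_le_div (hX n)]
      exact_mod_cast Nat.card_le_card_of_injective _ (j n).injective
    · have h1 : (Nat.card (Y n) : ℝ) ≤ Nat.card (Y₁ n) + C * ((Nat.card (Y₁ n) - Nat.card (X n))
          + (Nat.card (Y₂ n) - Nat.card (X n)) + 2 * D n) := by exact_mod_cast hcard n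
      refine (div_le_div_of_nonneg_right h1 (hX n).le).trans (le_of_eq ?_)
      have := (hX n).ne'
      field_simp

/-- A transitive action is determined up to isomorphism by the stabiliser of one point, and a finite
group has finitely many subsets. -/
theorem finite_irrP_of_finite [Finite H] : Finite (IrrP H) := by
  let x : ∀ c : IrrP H, (Quotient.out c).1.carrier := fun c => (Quotient.out c).2.1.some
  let S : IrrP H → Set H := fun c => {h | (Quotient.out c).1.hom h (x c) = x c}
  refine Finite.of_injective S fun c d hcd => ?_
  let f : ∀ c : IrrP H, H → (Quotient.out c).1.carrier := fun c h => (Quotient.out c).1.hom h (x c)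
  have hs : ∀ c, Function.Surjective (f c) := fun c y => (Quotient.out c).2.2 _ _
  have hf : ∀ h k, f c h = f c k ↔ f d h = f d k := fun h k => by
    have h1 := Set.ext_iff.1 hcd (k⁻¹ * h)
    exact (map_inv_mul_apply_eq_iff _ k h _).symm.trans
      (h1.trans (map_inv_mul_apply_eq_iff _ k h _))
  rw [← Quotient.out_eq c, ← Quotient.out_eq d]
  refine Quotient.sound ⟨⟨fun y => f d (Function.surjInv (hs c) y),
    fun y => f c (Function.surjInv (hs d) y), fun y => ?_, fun y => ?_⟩, fun h y => ?_⟩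
  · obtain ⟨k, rfl⟩ := hs c y
    exact (hf _ _).2 ((Function.surjInv_eq (hs d) _).trans ((hf _ _).1 (Function.surjInv_eq (hs c) _)))
  · obtain ⟨k, rfl⟩ := hs d y
    exact (hf _ _).1 ((Function.surjInv_eq (hs c) _).trans ((hf _ _).2 (Function.surjInv_eq (hs d) _)))
  · obtain ⟨k, rfl⟩ := hs c y
    have e : ∀ c : IrrP H, (Quotient.out c).1.hom h (f c k) = f c (h * k) := fun c => by simp [f]
    have e1 : ∀ k, f d (Function.surjInv (hs c) (f c k)) = f d k := fun k =>
      (hf _ _).1 (Function.surjInv_eq (hs c) _)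
    change f d (Function.surjInv (hs c) ((Quotient.out c).1.hom h (f c k)))
      = (Quotient.out d).1.hom h (f d (Function.surjInv (hs c) (f c k)))
    rw [e c, e1, e1, e d]

end Actions

/-! ### Multiplicities in unitary representations -/

namespace UnitaryRep

open Module

variable {H : Type*} [Group H]

/-- Equivariance of a map between unitary representations. -/
def Intertwines (ρ σ : UnitaryRep H) (T : ρ.space → σ.space) : Prop :=
  ∀ h v, T (ρ.hom h v) = σ.hom h (T v)

theorem hom_inv_apply_self (ρ : UnitaryRep H) (h : H) (v : ρ.space) :
    ρ.hom h⁻¹ (ρ.hom h v) = v := by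
  change (ρ.hom h⁻¹ * ρ.hom h) v = v
  rw [← map_mul, inv_mul_cancel, map_one]
  rfl

theorem hom_apply_inv_self (ρ : UnitaryRep H) (h : H) (v : ρ.space) :
    ρ.hom h (ρ.hom h⁻¹ v) = v := by
  have := ρ.hom_inv_apply_self h⁻¹ v
  rwa [inv_inv] at this

theorem inner_hom_left (ρ : UnitaryRep H) (h : H) (v w : ρ.space) :
    inner ℂ (ρ.hom h v) w = inner ℂ v (ρ.hom h⁻¹ w) := by
  rw [← LinearIsometryEquiv.inner_map_map (ρ.hom h⁻¹), hom_inv_apply_self]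

/-- Restriction of a representation to an invariant subspace. -/
noncomputable abbrev sub (ρ : UnitaryRep H) (S : Submodule ℂ ρ.space) (hS : ∀ h, ∀ v ∈ S, ρ.hom h v ∈ S) :
    UnitaryRep H where
  space := S
  hom :=
    { toFun := fun h =>
        { toFun := fun v => ⟨ρ.hom h v, hS h v v.2⟩
          invFun := fun v => ⟨ρ.hom h⁻¹ v, hS h⁻¹ v v.2⟩
          map_add' := fun v w => Subtype.ext (map_add (ρ.hom h) _ _)
          map_smul' := fun c v => Subtype.ext (map_smul (ρ.hom h) c _)
          left_inv := fun v => Subtype.ext (ρ.hom_inv_apply_self h v)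
          right_inv := fun v => Subtype.ext (ρ.hom_apply_inv_self h v)
          norm_map' := fun v => (ρ.hom h).norm_map v }
      map_one' := by
        ext v
        change ρ.hom 1 v = v
        rw [map_one]; rfl
      map_mul' := fun h k => by
        ext v
        change ρ.hom (h * k) v = ρ.hom h (ρ.hom k v)
        rw [map_mul]; rfl }

theorem orthogonal_invariant (ρ : UnitaryRep H) {S : Submodule ℂ ρ.space}
    (hS : ∀ h, ∀ v ∈ S, ρ.hom h v ∈ S) (h : H) (v : ρ.space) (hv : v ∈ Sᗮ) :
    ρ.hom h v ∈ Sᗮ := by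
  rw [Submodule.mem_orthogonal'] at hv ⊢
  intro u hu
  rw [inner_hom_left]
  exact hv _ (hS _ _ hu)

/-- The direct sum of two unitary representations. -/
noncomputable abbrev prod (ρ σ : UnitaryRep H) : UnitaryRep H where
  space := WithLp 2 (ρ.space × σ.space)
  hom :=
    { toFun := fun h => LinearIsometryEquiv.withLpProdCongr 2 (ρ.hom h) (σ.hom h)
      map_one' := by
        rw [map_one, map_one]
        rfl
      map_mul' := fun h k => by
        rw [map_mul, map_mul]
        rfl }

/-- Restriction of a representation along a homomorphism. -/
abbrev comap {G : Type*} [Group G] (i : H →* G) (ρ : UnitaryRep G) : UnitaryRep H where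
  space := ρ.space
  hom := ρ.hom.comp i

/-- The space of intertwining operators. -/
def intertwiners (ρ σ : UnitaryRep H) : Submodule ℂ (ρ.space →ₗ[ℂ] σ.space) where
  carrier := {T | ρ.Intertwines σ T}
  zero_mem' := fun h v => by simp
  add_mem' := fun {S T} hS hT h v => by
    simp [show S (ρ.hom h v) = _ from hS h v, show T (ρ.hom h v) = _ from hT h v]
  smul_mem' := fun c T hT h v => by simp [show T (ρ.hom h v) = _ from hT h v]

/-- The irreducible representation that represents an isomorphism class. -/
noncomputable abbrev rep (c : IrrHS H) : UnitaryRep H := (Quotient.out c).1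

/-- The multiplicity of an irreducible representation. -/
noncomputable def mult (ρ : UnitaryRep H) (c : IrrHS H) : ℕ := finrank ℂ (intertwiners (rep c) ρ)

theorem mult_eq_add {ρ σ τ : UnitaryRep H} (e : (σ.space × τ.space) ≃ₗ[ℂ] ρ.space)
    (he : ∀ h v w, e (σ.hom h v, τ.hom h w) = ρ.hom h (e (v, w))) (c : IrrHS H) :
    ρ.mult c = σ.mult c + τ.mult c := by
  have he' : ∀ h x, e.symm (ρ.hom h x) = (σ.hom h (e.symm x).1, τ.hom h (e.symm x).2) := by
    intro h x
    rw [LinearEquiv.symm_apply_eq, he]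
    simp
  let E : intertwiners (rep c) ρ ≃ₗ[ℂ] intertwiners (rep c) σ × intertwiners (rep c) τ :=
    { toFun := fun T => (⟨LinearMap.fst ℂ _ _ ∘ₗ e.symm.toLinearMap ∘ₗ T.1, fun h v => by
          have := T.2 h v
          simp [show T.1 ((rep c).hom h v) = _ from this, he']⟩,
        ⟨LinearMap.snd ℂ _ _ ∘ₗ e.symm.toLinearMap ∘ₗ T.1, fun h v => by
          have := T.2 h v
          simp [show T.1 ((rep c).hom h v) = _ from this, he']⟩)
      invFun := fun S => ⟨e.toLinearMap ∘ₗ S.1.1.prod S.2.1, fun h v => by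
          have h1 := S.1.2 h v
          have h2 := S.2.2 h v
          change e (S.1.1 ((rep c).hom h v), S.2.1 ((rep c).hom h v)) = ρ.hom h (e (S.1.1 v, S.2.1 v))
          rw [h1, h2, he]⟩
      map_add' := fun S T => by ext <;> simp
      map_smul' := fun a T => by ext <;> simp
      left_inv := fun T => by ext; simp
      right_inv := fun S => by ext <;> simp }
  rw [mult, E.finrank_eq, finrank_prod]
  rfl

theorem mult_prod (ρ σ : UnitaryRep H) (c : IrrHS H) :
    (ρ.prod σ).mult c = ρ.mult c + σ.mult c :=
  mult_eq_add (ρ := ρ.prod σ) (σ := ρ) (τ := σ) (WithLp.linearEquiv 2 ℂ _).symm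
    (fun _ _ _ => rfl) c

theorem mult_le (ρ : UnitaryRep H) (c : IrrHS H) :
    ρ.mult c ≤ finrank ℂ (rep c).space * finrank ℂ ρ.space := by
  rw [← finrank_linearMap]
  exact Submodule.finrank_le _

section Complement

variable {χ ρ : UnitaryRep H} (J : χ.space →ₗᵢ[ℂ] ρ.space)

theorem range_invariant (hJ : χ.Intertwines ρ J) (h : H) (v : ρ.space)
    (hv : v ∈ LinearMap.range J.toLinearMap) : ρ.hom h v ∈ LinearMap.range J.toLinearMap := by
  obtain ⟨x, rfl⟩ := hv
  exact ⟨χ.hom h x, hJ h x⟩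

/-- The orthogonal complement of a subrepresentation. -/
noncomputable abbrev compl (hJ : χ.Intertwines ρ J) : UnitaryRep H :=
  ρ.sub (LinearMap.range J.toLinearMap)ᗮ (ρ.orthogonal_invariant (range_invariant J hJ))

/-- The decomposition of a representation into a subrepresentation and its complement. -/
noncomputable def complEquiv :
    (χ.space × ((LinearMap.range J.toLinearMap)ᗮ : Submodule ℂ ρ.space)) ≃ₗ[ℂ] ρ.space :=
  (LinearEquiv.prodCongr (LinearEquiv.ofInjective J.toLinearMap J.injective)
      (LinearEquiv.refl ℂ _)).trans
    (Submodule.prodEquivOfIsCompl _ _ (LinearMap.range J.toLinearMap).isCompl_orthogonal)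

theorem complEquiv_apply (x : χ.space) (y : ((LinearMap.range J.toLinearMap)ᗮ : Submodule ℂ ρ.space)) :
    complEquiv J (x, y) = J x + y := rfl

theorem norm_complEquiv_sq (x : χ.space × ((LinearMap.range J.toLinearMap)ᗮ : Submodule ℂ ρ.space)) :
    ‖complEquiv J x‖ ^ 2 = ‖x.1‖ ^ 2 + ‖x.2‖ ^ 2 := by
  have h : inner ℂ (J x.1) (x.2 : ρ.space) = 0 := x.2.2 _ ⟨x.1, rfl⟩
  have := norm_add_sq_eq_norm_sq_add_norm_sq_of_inner_eq_zero _ _ h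
  rw [show x = (x.1, x.2) from rfl, complEquiv_apply, pow_two, this, J.norm_map]
  simp [pow_two]

theorem complEquiv_equivariant (hJ : χ.Intertwines ρ J) (h : H) (x : χ.space)
    (y : (compl J hJ).space) :
    complEquiv J (χ.hom h x, (compl J hJ).hom h y) = ρ.hom h (complEquiv J (x, y)) := by
  rw [complEquiv_apply, complEquiv_apply, map_add, ← hJ]
  rfl

theorem mult_eq_add_compl (hJ : χ.Intertwines ρ J) (c : IrrHS H) :
    ρ.mult c = χ.mult c + (compl J hJ).mult c :=
  mult_eq_add (ρ := ρ) (σ := χ) (τ := compl J hJ) (complEquiv J) (complEquiv_equivariant J hJ) c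

theorem finrank_eq_add_compl (hJ : χ.Intertwines ρ J) :
    finrank ℂ ρ.space = finrank ℂ χ.space + finrank ℂ (compl J hJ).space := by
  rw [← (complEquiv J).finrank_eq, finrank_prod]

/-- Isomorphisms of complements glue to isomorphisms that extend a partial isomorphism. -/
theorem exists_glue {σ : UnitaryRep H} (hJ : χ.Intertwines ρ J) (J' : χ.space →ₗᵢ[ℂ] σ.space)
    (hJ' : χ.Intertwines σ J') (g : (compl J hJ).space ≃ₗᵢ[ℂ] (compl J' hJ').space)
    (hg : (compl J hJ).Intertwines (compl J' hJ') g) :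
    ∃ U : ρ.space ≃ₗᵢ[ℂ] σ.space, ρ.Intertwines σ U ∧ ∀ x, U (J x) = J' x := by
  let L : ρ.space ≃ₗ[ℂ] σ.space := (complEquiv J).symm.trans
    ((LinearEquiv.prodCongr (LinearEquiv.refl ℂ _) g.toLinearEquiv).trans (complEquiv J'))
  have hL : ∀ x y, L (complEquiv J (x, y)) = complEquiv J' (x, g y) := fun x y => by
    simp [L]
  refine ⟨⟨L, fun v => ?_⟩, fun h v => ?_, fun x => ?_⟩
  · obtain ⟨⟨x, y⟩, rfl⟩ := (complEquiv J).surjective v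
    rw [hL, ← sq_eq_sq₀ (norm_nonneg _) (norm_nonneg _), norm_complEquiv_sq, norm_complEquiv_sq]
    simp
  · change L _ = σ.hom h (L v)
    obtain ⟨⟨x, y⟩, rfl⟩ := (complEquiv J).surjective v
    rw [← complEquiv_equivariant J hJ, hL, hL, ← complEquiv_equivariant J' hJ', hg]
  · have := hL x 0
    simpa [complEquiv_apply] using this

end Complement

/-- A nonzero invariant subspace of least dimension is irreducible. -/
theorem exists_irr_embedding (ρ : UnitaryRep H) [Nontrivial ρ.space] :
    ∃ (c : IrrHS H) (J : (rep c).space →ₗᵢ[ℂ] ρ.space), (rep c).Intertwines ρ J := by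
  let P : ℕ → Prop := fun n => ∃ S : Submodule ℂ ρ.space, (∀ h, ∀ v ∈ S, ρ.hom h v ∈ S) ∧
    S ≠ ⊥ ∧ finrank ℂ S = n
  have hP : ∃ n, P n := ⟨_, ⊤, fun _ _ _ => trivial, top_ne_bot, rfl⟩
  classical
  obtain ⟨S, hS, hS0, hSn⟩ := Nat.find_spec hP
  have hirr : (ρ.sub S hS).IsIrred := by
    refine ⟨S.nontrivial_iff_ne_bot.2 hS0, fun V hV => ?_⟩
    by_contra! hcon
    have hmap : P (finrank ℂ (V.map S.subtype)) := by
      refine ⟨V.map S.subtype, ?_, ?_, rfl⟩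
      · rintro h _ ⟨v, hv, rfl⟩
        exact ⟨_, hV h v hv, rfl⟩
      · intro h
        exact hcon.1 (Submodule.map_injective_of_injective S.injective_subtype
          (h.trans (Submodule.map_bot _).symm))
    have h1 := Nat.find_min' hP hmap
    rw [← hSn, Submodule.finrank_map_subtype_eq] at h1
    exact hcon.2 (Submodule.eq_top_of_finrank_eq (le_antisymm (Submodule.finrank_le _) h1))
  obtain ⟨u, hu⟩ := Quotient.mk_out (s := irrHSSetoid H) ⟨ρ.sub S hS, hirr⟩
  refine ⟨Quotient.mk _ ⟨ρ.sub S hS, hirr⟩, S.subtypeₗᵢ.comp u.toLinearIsometry, fun h v => ?_⟩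
  exact congrArg Subtype.val (hu h v)

/-- Induction by splitting off irreducible subrepresentations. -/
theorem induction_irr {p : UnitaryRep H → Prop} (h0 : ∀ ρ, Subsingleton ρ.space → p ρ)
    (hs : ∀ (ρ : UnitaryRep H) (c : IrrHS H) (J : (rep c).space →ₗᵢ[ℂ] ρ.space)
      (hJ : (rep c).Intertwines ρ J), p (compl J hJ) → p ρ) (ρ : UnitaryRep H) : p ρ := by
  induction hn : finrank ℂ ρ.space using Nat.strong_induction_on generalizing ρ with
  | _ n ih =>
    rcases subsingleton_or_nontrivial ρ.space with h | h
    · exact h0 ρ h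
    · obtain ⟨c, J, hJ⟩ := ρ.exists_irr_embedding
      refine hs ρ c J hJ (ih _ ?_ _ rfl)
      have h1 := finrank_eq_add_compl J hJ
      have : Nontrivial (rep c).space := (Quotient.out c).2.1
      have h2 : 0 < finrank ℂ (rep c).space := finrank_pos
      omega

theorem Intertwines.adjoint_comp {ρ σ : UnitaryRep H} {T : ρ.space →ₗ[ℂ] σ.space}
    (hT : ρ.Intertwines σ T) : ρ.Intertwines ρ (LinearMap.adjoint T ∘ₗ T) := by
  intro h v
  refine ext_inner_right ℂ fun w => ?_
  rw [LinearMap.comp_apply, LinearMap.comp_apply, LinearMap.adjoint_inner_left, inner_hom_left,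
    LinearMap.adjoint_inner_left, hT, show T (ρ.hom h⁻¹ w) = _ from hT h⁻¹ w, inner_hom_left]

/-- Schur's lemma: a non-zero intertwining operator from an irreducible representation is
proportional to an isometry. -/
theorem IsIrred.exists_isometry {χ ρ : UnitaryRep H} (hχ : χ.IsIrred)
    (T : χ.space →ₗ[ℂ] ρ.space) (hT : χ.Intertwines ρ T) (hT0 : T ≠ 0) :
    ∃ J : χ.space →ₗᵢ[ℂ] ρ.space, χ.Intertwines ρ J := by
  have := hχ.1
  -- Since `T* T` commutes with the representation, an eigenspace is invariant and nonzero, hence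
  -- everything. So `T` multiplies all norms by the constant `√μ`.
  let P : End ℂ χ.space := LinearMap.adjoint T ∘ₗ T
  have hP : ∀ h v, P (χ.hom h v) = χ.hom h (P v) := hT.adjoint_comp
  obtain ⟨μ, hμ⟩ := End.exists_eigenvalue P
  have htop : End.eigenspace P μ = ⊤ := by
    refine (hχ.2 _ fun h v hv => ?_).resolve_left hμ
    rw [End.mem_eigenspace_iff] at hv ⊢
    rw [hP, hv, map_smul]
  have hnorm : ∀ v, ‖T v‖ ^ 2 = μ.re * ‖v‖ ^ 2 := by
    intro v
    have hv : P v = μ • v := End.mem_eigenspace_iff.1 (htop ▸ Submodule.mem_top)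
    have h1 : inner ℂ v (P v) = inner ℂ (T v) (T v) := by
      simp only [P, LinearMap.comp_apply]
      rw [LinearMap.adjoint_inner_right]
    rw [hv, inner_smul_right, inner_self_eq_norm_sq_to_K, inner_self_eq_norm_sq_to_K] at h1
    have h2 := congrArg (RCLike.re (K := ℂ)) h1
    simp only [← RCLike.ofReal_pow, RCLike.ofReal_re, RCLike.mul_re, RCLike.ofReal_im, mul_zero,
      sub_zero] at h2
    exact h2.symm
  obtain ⟨v, hv⟩ : ∃ v, T v ≠ 0 := by
    by_contra! h
    exact hT0 (LinearMap.ext h)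
  have hv0 : v ≠ 0 := fun h => hv (by simp [h])
  have hpos : 0 < μ.re := by
    have h1 := hnorm v
    have h2 : 0 < ‖T v‖ ^ 2 := by positivity
    have h3 : 0 < ‖v‖ ^ 2 := by positivity
    rw [h1] at h2
    exact pos_of_mul_pos_left h2 h3.le
  refine ⟨⟨((Real.sqrt μ.re)⁻¹ : ℂ) • T, fun w => ?_⟩, fun h w => ?_⟩
  · rw [LinearMap.smul_apply, norm_smul, ← sq_eq_sq₀ (by positivity) (by positivity), mul_pow,
      hnorm, norm_inv, Complex.norm_real, Real.norm_of_nonneg (Real.sqrt_nonneg _), inv_pow,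
      Real.sq_sqrt hpos.le]
    field_simp
  · change ((Real.sqrt μ.re)⁻¹ : ℂ) • T (χ.hom h w) = ρ.hom h (((Real.sqrt μ.re)⁻¹ : ℂ) • T w)
    rw [map_smul, hT]

theorem exists_embedding_of_mult_ne_zero {ρ : UnitaryRep H} {c : IrrHS H} (h : ρ.mult c ≠ 0) :
    ∃ J : (rep c).space →ₗᵢ[ℂ] ρ.space, (rep c).Intertwines ρ J := by
  obtain ⟨T, hT⟩ : ∃ T : intertwiners (rep c) ρ, T ≠ 0 := by
    by_contra! hcon
    have : Subsingleton (intertwiners (rep c) ρ) := ⟨fun S T => (hcon S).trans (hcon T).symm⟩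
    exact h finrank_zero_of_subsingleton
  exact (Quotient.out c).2.exists_isometry T.1 T.2 fun h => hT (Subtype.ext h)

theorem mult_ne_zero_of_intertwines {ρ : UnitaryRep H} {c : IrrHS H}
    (T : (rep c).space →ₗ[ℂ] ρ.space) (hT : (rep c).Intertwines ρ T) (hT0 : T ≠ 0) :
    ρ.mult c ≠ 0 := by
  have : Nontrivial (intertwiners (rep c) ρ) :=
    ⟨⟨T, hT⟩, 0, fun h => hT0 (congrArg Subtype.val h)⟩
  exact finrank_pos.ne'

theorem mult_ne_zero_of_embedding {ρ : UnitaryRep H} {c : IrrHS H}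
    (J : (rep c).space →ₗᵢ[ℂ] ρ.space) (hJ : (rep c).Intertwines ρ J) : ρ.mult c ≠ 0 := by
  have : Nontrivial (rep c).space := (Quotient.out c).2.1
  obtain ⟨v, hv⟩ := exists_ne (0 : (rep c).space)
  refine mult_ne_zero_of_intertwines J.toLinearMap hJ fun h => hv ?_
  exact (map_eq_zero_iff J J.injective).1 (LinearMap.congr_fun h v)

/-- Schur's lemma gives an isometric embedding whose range is a nonzero invariant subspace of an
irreducible representation, so it is onto. -/
theorem eq_of_mult_rep_ne_zero {c d : IrrHS H} (h : (rep d).mult c ≠ 0) : c = d := by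
  obtain ⟨J, hJ⟩ := exists_embedding_of_mult_ne_zero h
  have : Nontrivial (rep c).space := (Quotient.out c).2.1
  have hsurj : LinearMap.range J.toLinearMap = ⊤ := by
    refine ((Quotient.out d).2.2 _ (range_invariant J hJ)).resolve_left fun hbot => ?_
    obtain ⟨v, hv⟩ := exists_ne (0 : (rep c).space)
    exact hv ((map_eq_zero_iff J J.injective).1
      (LinearMap.congr_fun (LinearMap.range_eq_bot.1 hbot) v))
  rw [← Quotient.out_eq c, ← Quotient.out_eq d]
  exact Quotient.sound ⟨LinearIsometryEquiv.ofSurjective J (LinearMap.range_eq_top.1 hsurj), hJ⟩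

theorem mult_eq_zero_of_subsingleton (ρ : UnitaryRep H) [Subsingleton ρ.space] (c : IrrHS H) :
    ρ.mult c = 0 := by
  have := ρ.mult_le c
  rw [finrank_zero_of_subsingleton (M := ρ.space)] at this
  omega

/-- Splitting off one irreducible summand removes at most its own class from the set. -/
theorem finite_setOf_mult_ne_zero (ρ : UnitaryRep H) : {c | ρ.mult c ≠ 0}.Finite := by
  induction ρ using induction_irr with
  | h0 ρ h =>
    simp [mult_eq_zero_of_subsingleton]
  | hs ρ d J hJ ih =>
    refine (ih.insert d).subset fun c hc => ?_
    rw [Set.mem_ofPred_eq, mult_eq_add_compl J hJ] at hc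
    by_cases h : (rep d).mult c = 0
    · exact Or.inr (by simpa [h] using hc)
    · exact Or.inl (eq_of_mult_rep_ne_zero h)

/-- Split the same irreducible off both sides. Multiplicities are additive, so the complements still
have equal multiplicities, and the induction continues with them. -/
theorem exists_iso_of_mult_eq (ρ σ : UnitaryRep H) (h : ρ.mult = σ.mult) :
    ∃ U : ρ.space ≃ₗᵢ[ℂ] σ.space, ρ.Intertwines σ U := by
  induction ρ using induction_irr generalizing σ with
  | h0 ρ hρ =>
    have hσ : Subsingleton σ.space := by
      by_contra hcon
      rw [not_subsingleton_iff_nontrivial] at hcon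
      obtain ⟨c, J, hJ⟩ := σ.exists_irr_embedding
      refine mult_ne_zero_of_embedding J hJ ?_
      rw [← h, mult_eq_zero_of_subsingleton]
    refine ⟨⟨LinearEquiv.ofSubsingleton _ _, fun v => ?_⟩, fun _ _ => Subsingleton.elim _ _⟩
    rw [Subsingleton.elim v 0]
    simp
  | hs ρ c J hJ ih =>
    obtain ⟨J', hJ'⟩ := exists_embedding_of_mult_ne_zero (h ▸ mult_ne_zero_of_embedding J hJ)
    obtain ⟨g, hg⟩ := ih (compl J' hJ') (by
      ext d
      have h1 := mult_eq_add_compl J hJ d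
      have h2 := mult_eq_add_compl J' hJ' d
      rw [h] at h1
      omega)
    obtain ⟨U, hU, -⟩ := exists_glue J hJ J' hJ' g hg
    exact ⟨U, hU⟩

theorem exists_extension_of_mult_eq {χ ρ σ : UnitaryRep H} (h : ρ.mult = σ.mult)
    (J : χ.space →ₗᵢ[ℂ] ρ.space) (hJ : χ.Intertwines ρ J) (J' : χ.space →ₗᵢ[ℂ] σ.space)
    (hJ' : χ.Intertwines σ J') :
    ∃ U : ρ.space ≃ₗᵢ[ℂ] σ.space, ρ.Intertwines σ U ∧ ∀ x, U (J x) = J' x := by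
  obtain ⟨g, hg⟩ := exists_iso_of_mult_eq (compl J hJ) (compl J' hJ') (by
    ext d
    have h1 := mult_eq_add_compl J hJ d
    have h2 := mult_eq_add_compl J' hJ' d
    rw [h] at h1
    omega)
  exact exists_glue J hJ J' hJ' g hg

/-- The common part `χ` cancels. What remains are the multiplicities in the two complements, bounded
crudely by dimensions of spaces of linear maps. -/
theorem abs_mult_sub_le {χ ρ σ : UnitaryRep H} (J : χ.space →ₗᵢ[ℂ] ρ.space)
    (hJ : χ.Intertwines ρ J) (J' : χ.space →ₗᵢ[ℂ] σ.space) (hJ' : χ.Intertwines σ J')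
    (c : IrrHS H) :
    |(ρ.mult c : ℤ) - σ.mult c| ≤ finrank ℂ (rep c).space *
      ((finrank ℂ ρ.space - finrank ℂ χ.space) + (finrank ℂ σ.space - finrank ℂ χ.space)) := by
  have h1 := mult_eq_add_compl J hJ c
  have h2 := mult_eq_add_compl J' hJ' c
  have h3 : ((compl J hJ).mult c : ℤ) ≤ finrank ℂ (rep c).space * finrank ℂ (compl J hJ).space :=
    by exact_mod_cast mult_le _ c
  have h4 : ((compl J' hJ').mult c : ℤ)
      ≤ finrank ℂ (rep c).space * finrank ℂ (compl J' hJ').space :=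
    by exact_mod_cast mult_le _ c
  rw [finrank_eq_add_compl J hJ, finrank_eq_add_compl J' hJ']
  push_cast
  rw [abs_le, h1, h2]
  push_cast
  constructor <;> linarith

/-- The regular representation of a finite group. -/
noncomputable abbrev regular [Finite H] : UnitaryRep H where
  space := EuclideanSpace ℂ (Fin (Nat.card H))
  hom :=
    { toFun := fun h => LinearIsometryEquiv.piLpCongrLeft 2 ℂ ℂ
        (((Finite.equivFin H).symm.trans (Equiv.mulLeft h)).trans (Finite.equivFin H))
      map_one' := by
        ext v k
        change v _ = v k
        simp
      map_mul' := fun h k => by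
        ext v l
        change v _ = v _
        simp [mul_assoc] }

/-- The matrix coefficients `v ↦ (k ↦ ⟨u, k⁻¹ v⟩)` intertwine with left translation, and the one for
`v = u` at `k = 1` is `‖u‖²`, which is nonzero. -/
theorem mult_regular_ne_zero [Finite H] (c : IrrHS H) : (regular (H := H)).mult c ≠ 0 := by
  have : Nontrivial (rep c).space := (Quotient.out c).2.1
  obtain ⟨u, hu⟩ := exists_ne (0 : (rep c).space)
  let T : (rep c).space →ₗ[ℂ] EuclideanSpace ℂ (Fin (Nat.card H)) :=
    (WithLp.linearEquiv 2 ℂ _).symm.toLinearMap ∘ₗ LinearMap.pi fun k =>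
      (innerₛₗ ℂ u) ∘ₗ ((rep c).hom ((Finite.equivFin H).symm k)⁻¹).toLinearEquiv.toLinearMap
  have hT : ∀ v k, T v k = inner ℂ u ((rep c).hom ((Finite.equivFin H).symm k)⁻¹ v) :=
    fun _ _ => rfl
  refine mult_ne_zero_of_intertwines (ρ := regular) T (fun h v => ?_) fun h => ?_
  · refine PiLp.ext fun k => ?_
    change T _ k = T v (Finite.equivFin H (h⁻¹ * (Finite.equivFin H).symm k))
    rw [hT, hT, Equiv.symm_apply_apply, mul_inv_rev, inv_inv, map_mul]
    rfl
  · have h1 : T u (Finite.equivFin H 1) = 0 := by rw [h]; rfl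
    rw [hT] at h1
    simp at h1
    exact hu h1

end UnitaryRep

theorem finite_irrHS_of_finite {H : Type*} [Group H] [Finite H] : Finite (IrrHS H) := by
  have h := (UnitaryRep.regular (H := H)).finite_setOf_mult_ne_zero
  rw [Set.eq_univ_of_forall UnitaryRep.mult_regular_ne_zero] at h
  exact Set.finite_univ_iff.1 h

/-! ### Finite-dimensional representations of a group with finitely many irreducible ones -/

namespace UnitaryRep

open Module TensorProduct

variable {H : Type*} [Group H]

/-- The tensor product of two unitary representations. -/
noncomputable abbrev tensor (ρ σ : UnitaryRep H) : UnitaryRep H where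
  space := ρ.space ⊗[ℂ] σ.space
  hom :=
    { toFun := fun h => TensorProduct.congrIsometry (ρ.hom h) (σ.hom h)
      map_one' := by
        ext x
        induction x using TensorProduct.induction_on with
        | zero => simp
        | tmul x y => rw [map_one, map_one, congrIsometry_apply]; rfl
        | add x y hx hy => rw [map_add, map_add, hx, hy]
      map_mul' := fun h k => by
        ext x
        induction x using TensorProduct.induction_on with
        | zero => simp
        | tmul x y => rw [map_mul, map_mul]; rfl
        | add x y hx hy => rw [map_add, map_add, hx, hy] }

/-- The functions `h ↦ F (ρ h)` for linear forms `F`: the matrix coefficients of `ρ`. -/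
noncomputable def coefficientMap (ρ : UnitaryRep H) : Dual ℂ (End ℂ ρ.space) →ₗ[ℂ] (H → ℂ) :=
  LinearMap.pi fun h => LinearMap.applyₗ (unitaryToLin (ρ.hom h))

theorem coefficientMap_apply (ρ : UnitaryRep H) (F : Dual ℂ (End ℂ ρ.space)) (h : H) :
    ρ.coefficientMap F h = F (unitaryToLin (ρ.hom h)) := rfl

/-- The algebra of matrix coefficients of finite-dimensional unitary representations. -/
noncomputable def coefficientAlgebra (H : Type*) [Group H] : Subalgebra ℂ (H → ℂ) where
  carrier := {f | ∃ ρ : UnitaryRep H, f ∈ LinearMap.range ρ.coefficientMap}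
  mul_mem' := by
    rintro _ _ ⟨ρ, F, rfl⟩ ⟨σ, F', rfl⟩
    -- A product of matrix coefficients is a matrix coefficient of the tensor product.
    refine ⟨ρ.tensor σ, (LinearMap.mul' ℂ ℂ ∘ₗ TensorProduct.map F F') ∘ₗ
      (homTensorHomEquiv ℂ ρ.space σ.space ρ.space σ.space).symm.toLinearMap, ?_⟩
    ext h
    have h1 : (homTensorHomEquiv ℂ ρ.space σ.space ρ.space σ.space).symm
        (unitaryToLin ((ρ.tensor σ).hom h))
        = unitaryToLin (ρ.hom h) ⊗ₜ[ℂ] unitaryToLin (σ.hom h) := by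
      rw [LinearEquiv.symm_apply_eq, homTensorHomEquiv_apply, homTensorHomMap_apply]
      rfl
    refine (congrArg (LinearMap.mul' ℂ ℂ ∘ₗ TensorProduct.map F F') h1).trans ?_
    rw [LinearMap.comp_apply, map_tmul, LinearMap.mul'_apply]
    rfl
  add_mem' := by
    rintro _ _ ⟨ρ, F, rfl⟩ ⟨σ, F', rfl⟩
    let e := WithLp.linearEquiv 2 ℂ (ρ.space × σ.space)
    let A : End ℂ (WithLp 2 (ρ.space × σ.space)) →ₗ[ℂ] End ℂ ρ.space :=
      { toFun := fun T => LinearMap.fst ℂ _ _ ∘ₗ e.toLinearMap ∘ₗ T ∘ₗ e.symm.toLinearMap ∘ₗ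
          LinearMap.inl ℂ _ _
        map_add' := fun S T => by ext; simp
        map_smul' := fun c T => by ext; simp }
    let B : End ℂ (WithLp 2 (ρ.space × σ.space)) →ₗ[ℂ] End ℂ σ.space :=
      { toFun := fun T => LinearMap.snd ℂ _ _ ∘ₗ e.toLinearMap ∘ₗ T ∘ₗ e.symm.toLinearMap ∘ₗ
          LinearMap.inr ℂ _ _
        map_add' := fun S T => by ext; simp
        map_smul' := fun c T => by ext; simp }
    refine ⟨ρ.prod σ, F ∘ₗ A + F' ∘ₗ B, ?_⟩
    ext h
    rfl
  algebraMap_mem' := fun c =>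
    ⟨⟨ℂ, 1⟩, c • LinearMap.applyₗ (1 : ℂ), by
      ext h
      exact mul_one c⟩

/-- In a direct sum every operator of the representation is block diagonal, so its coefficients are
sums of coefficients of the summands. -/
theorem range_coefficientMap_le (ρ : UnitaryRep H) :
    LinearMap.range ρ.coefficientMap ≤ ⨆ c : IrrHS H, LinearMap.range (rep c).coefficientMap := by
  induction ρ using induction_irr with
  | h0 ρ hρ =>
    rintro _ ⟨F, rfl⟩
    have : ρ.coefficientMap F = 0 := by
      ext h
      rw [coefficientMap_apply, Subsingleton.elim (unitaryToLin (ρ.hom h)) 0, map_zero]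
      rfl
    rw [this]
    exact Submodule.zero_mem _
  | hs ρ c J hJ ih =>
    rintro _ ⟨F, rfl⟩
    let e := complEquiv J
    let A : End ℂ (rep c).space →ₗ[ℂ] End ℂ ρ.space :=
      { toFun := fun T => J.toLinearMap ∘ₗ T ∘ₗ LinearMap.fst ℂ _ _ ∘ₗ e.symm.toLinearMap
        map_add' := fun S T => by ext; simp
        map_smul' := fun c T => by ext; simp }
    let B : End ℂ (compl J hJ).space →ₗ[ℂ] End ℂ ρ.space :=
      { toFun := fun T => Submodule.subtype _ ∘ₗ T ∘ₗ LinearMap.snd ℂ _ _ ∘ₗ e.symm.toLinearMap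
        map_add' := fun S T => by ext; simp
        map_smul' := fun c T => by ext; simp }
    have h1 : ρ.coefficientMap F
        = (rep c).coefficientMap (F ∘ₗ A) + (compl J hJ).coefficientMap (F ∘ₗ B) := by
      ext h
      rw [Pi.add_apply, coefficientMap_apply, coefficientMap_apply, coefficientMap_apply,
        LinearMap.comp_apply, LinearMap.comp_apply, ← map_add]
      congr 1
      ext v
      obtain ⟨⟨x, y⟩, rfl⟩ := e.surjective v
      refine (complEquiv_equivariant J hJ h x y).symm.trans ?_
      rw [complEquiv_apply]
      simp [A, B, unitaryToLin]
    rw [h1]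
    exact Submodule.add_mem _ (Submodule.mem_iSup_of_mem c ⟨_, rfl⟩) (ih ⟨_, rfl⟩)

theorem finiteDimensional_coefficientAlgebra [Finite (IrrHS H)] :
    FiniteDimensional ℂ (coefficientAlgebra H) := by
  have hle : Subalgebra.toSubmodule (coefficientAlgebra H)
      ≤ ⨆ c : IrrHS H, LinearMap.range (rep c).coefficientMap := by
    rintro f ⟨ρ, hf⟩
    exact range_coefficientMap_le ρ hf
  exact Submodule.finiteDimensional_of_le hle

/-- If there are finitely many irreducible representations, then all finite-dimensional
representations factor through one finite quotient. -/
theorem exists_finite_quotient [Finite (IrrHS H)] :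
    ∃ N : Subgroup H, N.Normal ∧ Finite (H ⧸ N) ∧ ∀ (ρ : UnitaryRep H), ∀ h ∈ N, ρ.hom h = 1 := by
  have := finiteDimensional_coefficientAlgebra (H := H)
  -- A finite-dimensional algebra has finitely many characters. Evaluations at elements of `H` are
  -- characters, and equal evaluations force equal operators in every representation, because linear
  -- forms separate operators.
  let ev : H → (coefficientAlgebra H →ₐ[ℂ] ℂ) := fun h =>
    (Pi.evalAlgHom ℂ (fun _ : H => ℂ) h).comp (coefficientAlgebra H).val
  have hev : ∀ h k, ev h = ev k → ∀ ρ : UnitaryRep H, ρ.hom h = ρ.hom k := by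
    intro h k hhk ρ
    have h1 : unitaryToLin (ρ.hom h) = unitaryToLin (ρ.hom k) := by
      rw [← sub_eq_zero, ← Module.forall_dual_apply_eq_zero_iff ℂ]
      intro F
      have h2 := DFunLike.congr_fun hhk ⟨ρ.coefficientMap F, ρ, F, rfl⟩
      rw [map_sub, sub_eq_zero]
      exact h2
    ext v
    exact LinearMap.congr_fun h1 v
  refine ⟨⨅ ρ : UnitaryRep H, ρ.hom.ker, ?_, ?_, fun ρ h hh => ?_⟩
  · exact Subgroup.normal_iInf_normal fun ρ => inferInstance
  · refine Finite.of_injective (fun q : H ⧸ _ => ev q.out) fun q r hqr => ?_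
    rw [← QuotientGroup.out_eq' q, ← QuotientGroup.out_eq' r, QuotientGroup.eq,
      Subgroup.mem_iInf]
    intro ρ
    rw [MonoidHom.mem_ker, map_mul, map_inv, hev _ _ hqr ρ, inv_mul_cancel]
  · exact Subgroup.mem_iInf.1 hh ρ

end UnitaryRep

/-! ### The Hilbert-Schmidt norm -/

section Frobenius

open Module

variable {V W W' : Type*} [NormedAddCommGroup V] [InnerProductSpace ℂ V] [FiniteDimensional ℂ V]
  [NormedAddCommGroup W] [InnerProductSpace ℂ W] [FiniteDimensional ℂ W]
  [NormedAddCommGroup W'] [InnerProductSpace ℂ W'] [FiniteDimensional ℂ W']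

/-- The (not normalised) Hilbert-Schmidt norm of an operator. -/
noncomputable def frob (T : V →ₗ[ℂ] W) : ℝ :=
  Real.sqrt (LinearMap.trace ℂ V (LinearMap.adjoint T ∘ₗ T)).re

theorem re_trace_eq_sum {ι : Type*} [Fintype ι] (b : OrthonormalBasis ι ℂ V) (T : V →ₗ[ℂ] W) :
    (LinearMap.trace ℂ V (LinearMap.adjoint T ∘ₗ T)).re = ∑ i, ‖T (b i)‖ ^ 2 := by
  rw [LinearMap.trace_eq_sum_inner _ b, Complex.re_sum]
  refine Finset.sum_congr rfl fun i _ => ?_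
  rw [LinearMap.comp_apply, LinearMap.adjoint_inner_right]
  exact inner_self_eq_norm_sq (𝕜 := ℂ) _

theorem frob_sq {ι : Type*} [Fintype ι] (b : OrthonormalBasis ι ℂ V) (T : V →ₗ[ℂ] W) :
    frob T ^ 2 = ∑ i, ‖T (b i)‖ ^ 2 := by
  rw [frob, re_trace_eq_sum b, Real.sq_sqrt (Finset.sum_nonneg fun _ _ => sq_nonneg _)]

theorem frob_nonneg (T : V →ₗ[ℂ] W) : 0 ≤ frob T := Real.sqrt_nonneg _

theorem hsNorm_eq (A : V →ₗ[ℂ] V) : hsNorm A = frob A / Real.sqrt (finrank ℂ V) := by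
  rw [hsNorm, frob, Real.sqrt_div' _ (Nat.cast_nonneg _)]

theorem frob_eq_norm {ι : Type*} [Fintype ι] (b : OrthonormalBasis ι ℂ V) (T : V →ₗ[ℂ] W) :
    frob T = ‖(WithLp.toLp 2 fun i => T (b i) : PiLp 2 fun _ : ι => W)‖ := by
  rw [← sq_eq_sq₀ (frob_nonneg _) (norm_nonneg _), frob_sq b, PiLp.norm_sq_eq_of_L2]

theorem frob_add_le (S T : V →ₗ[ℂ] W) : frob (S + T) ≤ frob S + frob T := by
  let b := stdOrthonormalBasis ℂ V
  have h := norm_add_le (WithLp.toLp 2 fun i => S (b i) : PiLp 2 fun _ => W)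
    (WithLp.toLp 2 fun i => T (b i) : PiLp 2 fun _ => W)
  rw [← frob_eq_norm b, ← frob_eq_norm b, ← WithLp.toLp_add] at h
  rw [frob_eq_norm b]
  exact h

theorem frob_smul (c : ℂ) (T : V →ₗ[ℂ] W) : frob (c • T) = ‖c‖ * frob T := by
  let b := stdOrthonormalBasis ℂ V
  rw [← sq_eq_sq₀ (frob_nonneg _) (mul_nonneg (norm_nonneg _) (frob_nonneg _)), mul_pow,
    frob_sq b, frob_sq b, Finset.mul_sum]
  exact Finset.sum_congr rfl fun i _ => by rw [LinearMap.smul_apply, norm_smul, mul_pow]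

theorem frob_neg (T : V →ₗ[ℂ] W) : frob (-T) = frob T := by
  rw [← neg_one_smul ℂ, frob_smul]
  simp

theorem frob_sub_comm (S T : V →ₗ[ℂ] W) : frob (S - T) = frob (T - S) := by
  rw [← frob_neg, neg_sub]

theorem frob_sub_le_add (R S T : V →ₗ[ℂ] W) : frob (R - T) ≤ frob (R - S) + frob (S - T) := by
  rw [← sub_add_sub_cancel R S T]
  exact frob_add_le _ _

theorem frob_sum_le {ι : Type*} (s : Finset ι) (T : ι → V →ₗ[ℂ] W) :
    frob (∑ i ∈ s, T i) ≤ ∑ i ∈ s, frob (T i) := by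
  classical
  induction s using Finset.induction_on with
  | empty => simp [frob]
  | insert a s ha ih =>
    rw [Finset.sum_insert ha, Finset.sum_insert ha]
    exact (frob_add_le _ _).trans (by gcongr)

theorem frob_le_frob (S : V →ₗ[ℂ] W) (T : V →ₗ[ℂ] W') (h : ∀ v, ‖S v‖ ≤ ‖T v‖) :
    frob S ≤ frob T := by
  let b := stdOrthonormalBasis ℂ V
  rw [← sq_le_sq₀ (frob_nonneg _) (frob_nonneg _), frob_sq b, frob_sq b]
  gcongr
  exact h _

theorem frob_eq_frob (S : V →ₗ[ℂ] W) (T : V →ₗ[ℂ] W') (h : ∀ v, ‖S v‖ = ‖T v‖) :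
    frob S = frob T :=
  le_antisymm (frob_le_frob _ _ fun v => (h v).le) (frob_le_frob _ _ fun v => (h v).ge)

theorem frob_adjoint (T : V →ₗ[ℂ] W) : frob (LinearMap.adjoint T) = frob T := by
  rw [frob, frob, LinearMap.adjoint_adjoint, LinearMap.trace_comp_comm']

theorem norm_adjoint_apply_le (K : V →ₗ[ℂ] W) (hK : ∀ v, ‖K v‖ ≤ ‖v‖) (w : W) :
    ‖LinearMap.adjoint K w‖ ≤ ‖w‖ := by
  rcases eq_or_ne (LinearMap.adjoint K w) 0 with h | h
  · rw [h, norm_zero]; exact norm_nonneg _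
  · have h1 : ‖LinearMap.adjoint K w‖ ^ 2 ≤ ‖w‖ * ‖LinearMap.adjoint K w‖ := by
      rw [← inner_self_eq_norm_sq (𝕜 := ℂ), LinearMap.adjoint_inner_left]
      refine (re_inner_le_norm _ _).trans ?_
      gcongr
      exact hK _
    rw [pow_two] at h1
    exact le_of_mul_le_mul_right h1 (norm_pos_iff.2 h)

/-- Taking adjoints moves the contraction to the left, where norms compare pointwise. -/
theorem frob_comp_le (T : W →ₗ[ℂ] W') (K : V →ₗ[ℂ] W) (hK : ∀ v, ‖K v‖ ≤ ‖v‖) :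
    frob (T ∘ₗ K) ≤ frob T := by
  rw [← frob_adjoint, LinearMap.adjoint_comp, ← frob_adjoint T]
  exact frob_le_frob _ _ fun w => norm_adjoint_apply_le K hK _

theorem frob_sq_of_isometry (T : V →ₗ[ℂ] W) (hT : ∀ v, ‖T v‖ = ‖v‖) :
    frob T ^ 2 = finrank ℂ V := by
  let b := stdOrthonormalBasis ℂ V
  rw [frob_sq b]
  simp [hT]

theorem adjoint_comp_isometry (j : V →ₗᵢ[ℂ] W) (v : V) :
    LinearMap.adjoint j.toLinearMap (j v) = v := by
  refine ext_inner_right ℂ fun w => ?_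
  rw [LinearMap.adjoint_inner_left]
  exact j.inner_map_map v w

/-- The defect of equivariance of an inclusion `j` with respect to unitaries `a` and `b`. -/
noncomputable def defect (j : V →ₗᵢ[ℂ] W) (a : V ≃ₗᵢ[ℂ] V) (b : W ≃ₗᵢ[ℂ] W) : ℝ :=
  frob (unitaryToLin b ∘ₗ j.toLinearMap - j.toLinearMap ∘ₗ unitaryToLin a)

theorem hsNorm_sub_compression_le (j : V →ₗᵢ[ℂ] W) (a : V ≃ₗᵢ[ℂ] V) (b : W ≃ₗᵢ[ℂ] W) :
    hsNorm (unitaryToLin a - compression j b) ≤ defect j a b / Real.sqrt (finrank ℂ V) := by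
  rw [hsNorm_eq]
  gcongr
  rw [defect, frob_sub_comm (unitaryToLin b ∘ₗ j.toLinearMap)]
  refine frob_le_frob _ _ fun v => ?_
  have h1 : (unitaryToLin a - compression j b) v = LinearMap.adjoint j.toLinearMap
      ((j.toLinearMap ∘ₗ unitaryToLin a - unitaryToLin b ∘ₗ j.toLinearMap) v) := by
    rw [LinearMap.sub_apply, LinearMap.sub_apply, map_sub]
    congr 1
    exact (adjoint_comp_isometry j (a v)).symm
  rw [h1]
  exact norm_adjoint_apply_le _ (fun v => (j.norm_map v).le) _

/-- Closeness of a compression forces near equivariance: `‖b j v - j a v‖² = 2 Re ⟨A v, a v⟩ ≤ 2 ‖A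
v‖ ‖v‖`. Cauchy-Schwarz over an orthonormal basis then produces the factor `√dim V`. -/
theorem defect_sq_le (j : V →ₗᵢ[ℂ] W) (a : V ≃ₗᵢ[ℂ] V) (b : W ≃ₗᵢ[ℂ] W) :
    defect j a b ^ 2
      ≤ 2 * (Real.sqrt (finrank ℂ V) * frob (unitaryToLin a - compression j b)) := by
  let e := stdOrthonormalBasis ℂ V
  set A := unitaryToLin a - compression j b with hA
  have h1 : ∀ v, ‖(unitaryToLin b ∘ₗ j.toLinearMap - j.toLinearMap ∘ₗ unitaryToLin a) v‖ ^ 2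
      ≤ 2 * (‖v‖ * ‖A v‖) := by
    intro v
    have e1 : (unitaryToLin b ∘ₗ j.toLinearMap - j.toLinearMap ∘ₗ unitaryToLin a) v
        = b (j v) - j (a v) := rfl
    have e2 : A v = a v - LinearMap.adjoint j.toLinearMap (b (j v)) := rfl
    have e3 : inner ℂ (A v) (a v) = inner ℂ (a v) (a v) - inner ℂ (b (j v)) (j (a v)) := by
      rw [e2, inner_sub_left, LinearMap.adjoint_inner_left]
      rfl
    have e4 := congrArg (RCLike.re (K := ℂ)) e3
    rw [map_sub, inner_self_eq_norm_sq, a.norm_map] at e4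
    have e5 := re_inner_le_norm (𝕜 := ℂ) (A v) (a v)
    rw [a.norm_map] at e5
    rw [e1, norm_sub_sq (𝕜 := ℂ), b.norm_map, j.norm_map, j.norm_map, a.norm_map]
    nlinarith
  have h2 : defect j a b ^ 2 ≤ 2 * ∑ i, ‖A (e i)‖ := by
    rw [defect, frob_sq e, Finset.mul_sum]
    refine Finset.sum_le_sum fun i _ => (h1 _).trans ?_
    rw [e.norm_eq_one, one_mul]
  refine h2.trans ?_
  gcongr
  rw [← Real.sqrt_sq (frob_nonneg A), ← Real.sqrt_mul (Nat.cast_nonneg _), frob_sq e]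
  refine Real.le_sqrt_of_sq_le ?_
  refine sq_sum_le_card_mul_sum_sq.trans (le_of_eq ?_)
  simp

/-- The reason for working with defects: compressions are not multiplicative, whereas defects add up
along products. -/
theorem defect_mul_le (j : V →ₗᵢ[ℂ] W) (a a' c : V ≃ₗᵢ[ℂ] V) (b b' : W ≃ₗᵢ[ℂ] W) :
    defect j c (b * b') ≤ frob (unitaryToLin (a * a') - unitaryToLin c)
      + (defect j a b + defect j a' b') := by
  have h1 : unitaryToLin (b * b') ∘ₗ j.toLinearMap - j.toLinearMap ∘ₗ unitaryToLin c
      = j.toLinearMap ∘ₗ (unitaryToLin (a * a') - unitaryToLin c) +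
        ((unitaryToLin b ∘ₗ j.toLinearMap - j.toLinearMap ∘ₗ unitaryToLin a) ∘ₗ unitaryToLin a'
        + unitaryToLin b ∘ₗ (unitaryToLin b' ∘ₗ j.toLinearMap
          - j.toLinearMap ∘ₗ unitaryToLin a')) := by
    ext v
    simp [unitaryToLin]
  rw [defect, h1]
  refine (frob_add_le _ _).trans (add_le_add (frob_le_frob _ _ fun v => (j.norm_map _).le)
    ((frob_add_le _ _).trans (add_le_add ?_ ?_)))
  · exact frob_comp_le _ _ fun v => (a'.norm_map v).le
  · exact frob_le_frob _ _ fun v => (b.norm_map _).le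

/-- The partial isometry in the polar decomposition of a contraction `T`, as `T` times a
polynomial in `T* T`. -/
theorem exists_polynomial_partial_isometry (T : V →ₗ[ℂ] W) (hT : ∀ v, ‖T v‖ ≤ ‖v‖) :
    ∃ p : Polynomial ℂ, ∃ U : V →ₗ[ℂ] W,
      U = T ∘ₗ Polynomial.aeval (LinearMap.adjoint T ∘ₗ T : End ℂ V) p ∧
      (∀ v ∈ (LinearMap.ker U)ᗮ, ‖U v‖ = ‖v‖) ∧
      frob (U - T) ^ 2 ≤ finrank ℂ V - frob T ^ 2 ∧
      (finrank ℂ (LinearMap.ker U) : ℝ) ≤ finrank ℂ V - frob T ^ 2 := by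
  classical
  set P : End ℂ V := LinearMap.adjoint T ∘ₗ T with hP
  have hsymm : P.IsSymmetric := fun v w => by
    rw [hP, LinearMap.comp_apply, LinearMap.comp_apply, LinearMap.adjoint_inner_left,
      LinearMap.adjoint_inner_right]
  let b := hsymm.eigenvectorBasis rfl
  let μ : Fin (finrank ℂ V) → ℝ := hsymm.eigenvalues rfl
  have hPb : ∀ i, P (b i) = (μ i : ℂ) • b i := hsymm.apply_eigenvectorBasis rfl
  -- On the spectrum of `T* T` the polynomial `p` takes the values of `x ↦ x^(-1/2)`, with `0` at
  -- `0`. A polynomial is used so that `U` inherits every intertwining relation of `T`.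
  let g : ℝ → ℝ := fun x => if x = 0 then 0 else (Real.sqrt x)⁻¹
  let s : Finset ℂ := Finset.univ.image fun i => (μ i : ℂ)
  let p : Polynomial ℂ := Lagrange.interpolate s id fun z => (g z.re : ℂ)
  have hp : ∀ i, p.eval (μ i : ℂ) = (g (μ i) : ℂ) := fun i => by
    have := Lagrange.eval_interpolate_at_node (s := s) (v := id) (i := (μ i : ℂ))
      (fun z => (g z.re : ℂ)) Function.injective_id.injOn (by simp [s])
    simpa only [id_eq, Complex.ofReal_re] using this
  let U : V →ₗ[ℂ] W := T ∘ₗ Polynomial.aeval P p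
  have hUb : ∀ i, U (b i) = (g (μ i) : ℂ) • T (b i) := by
    intro i
    have h1 : End.HasEigenvector P (μ i : ℂ) (b i) :=
      ⟨End.mem_eigenspace_iff.2 (hPb i), b.orthonormal.ne_zero i⟩
    rw [← hp, ← map_smul, ← End.aeval_apply_of_hasEigenvector h1]
    rfl
  have hTb : ∀ i j, inner ℂ (T (b i)) (T (b j)) = if i = j then (μ j : ℂ) else 0 := by
    intro i j
    rw [← LinearMap.adjoint_inner_right, ← LinearMap.comp_apply, ← hP, hPb, inner_smul_right,
      orthonormal_iff_ite.1 b.orthonormal]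
    simp
  have hnorm : ∀ i, ‖T (b i)‖ ^ 2 = μ i := by
    intro i
    rw [← inner_self_eq_norm_sq (𝕜 := ℂ), hTb, if_pos rfl]
    exact Complex.ofReal_re _
  have hμ0 : ∀ i, 0 ≤ μ i := fun i => hnorm i ▸ sq_nonneg _
  have hμ1 : ∀ i, μ i ≤ 1 := fun i => by
    rw [← hnorm i]
    have := hT (b i)
    rw [b.orthonormal.norm_eq_one] at this
    exact pow_le_one₀ (norm_nonneg _) this
  let χ : Fin (finrank ℂ V) → ℝ := fun i => if μ i = 0 then 0 else 1
  have hgχ : ∀ i, g (μ i) * (g (μ i) * μ i) = χ i := by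
    intro i
    by_cases h : μ i = 0
    · simp [g, χ, h]
    · simp only [g, χ, h, if_false]
      have h1 := Real.mul_self_sqrt (hμ0 i)
      have h2 : Real.sqrt (μ i) ≠ 0 := (Real.sqrt_pos.2 ((hμ0 i).lt_of_ne' h)).ne'
      nth_rewrite 3 [← h1]
      field_simp
  have hUU : ∀ i j, inner ℂ (U (b i)) (U (b j)) = if i = j then (χ j : ℂ) else 0 := by
    intro i j
    rw [hUb, hUb, inner_smul_left, inner_smul_right, hTb]
    split_ifs with h
    · subst h
      rw [← hgχ]
      simp
    · simp
  have hQb : ∀ i, LinearMap.adjoint U (U (b i)) = (χ i : ℂ) • b i := by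
    intro i
    refine InnerProductSpace.ext_inner_left_basis b.toBasis fun k => ?_
    rw [b.coe_toBasis, LinearMap.adjoint_inner_right, hUU, inner_smul_right,
      orthonormal_iff_ite.1 b.orthonormal]
    split_ifs with h <;> simp
  have hUQ : ∀ v, U (LinearMap.adjoint U (U v)) = U v := by
    have : U ∘ₗ LinearMap.adjoint U ∘ₗ U = U := by
      refine b.toBasis.ext fun i => ?_
      rw [b.coe_toBasis]
      change U (LinearMap.adjoint U (U (b i))) = U (b i)
      rw [hQb, map_smul]
      by_cases h : μ i = 0
      · simp [hUb, g, h]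
      · simp [χ, h]
    exact LinearMap.congr_fun this
  have hUnorm : ∀ i, ‖U (b i)‖ ^ 2 = χ i := by
    intro i
    rw [← inner_self_eq_norm_sq (𝕜 := ℂ), hUU, if_pos rfl]
    exact Complex.ofReal_re _
  have hχμ : ∀ i, μ i ≤ χ i := by
    intro i
    by_cases h : μ i = 0
    · simp [χ, h]
    · simpa [χ, h] using hμ1 i
  refine ⟨p, U, rfl, fun v hv => ?_, ?_, ?_⟩
  · have h1 : LinearMap.adjoint U (U v) - v ∈ LinearMap.ker U := by
      rw [LinearMap.mem_ker, map_sub, hUQ, sub_self]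
    have h2 : LinearMap.adjoint U (U v) - v ∈ (LinearMap.ker U)ᗮ := by
      refine Submodule.sub_mem _ (fun u hu => ?_) hv
      rw [LinearMap.adjoint_inner_right, LinearMap.mem_ker.1 hu, inner_zero_left]
    have h3 : LinearMap.adjoint U (U v) = v := by
      rw [← sub_eq_zero]
      have := h2 _ h1
      exact inner_self_eq_zero.1 this
    rw [← sq_eq_sq₀ (norm_nonneg _) (norm_nonneg _), ← inner_self_eq_norm_sq (𝕜 := ℂ),
      ← LinearMap.adjoint_inner_right, h3, inner_self_eq_norm_sq]
  · rw [frob_sq b, frob_sq b]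
    have h1 : (finrank ℂ V : ℝ) = ∑ _i : Fin (finrank ℂ V), (1 : ℝ) := by simp
    rw [h1, ← Finset.sum_sub_distrib]
    refine Finset.sum_le_sum fun i _ => ?_
    rw [LinearMap.sub_apply, hUb, hnorm]
    have h2 : (g (μ i) : ℂ) • T (b i) - T (b i) = ((g (μ i) - 1 : ℝ) : ℂ) • T (b i) := by
      rw [Complex.ofReal_sub, Complex.ofReal_one, sub_smul, one_smul]
    rw [h2, norm_smul, mul_pow, hnorm, Complex.norm_real, Real.norm_eq_abs, sq_abs]
    -- For `μ ≠ 0` this is `(1 - √μ)²`, which is at most `1 - μ` because `μ ≤ √μ` on `[0, 1]`.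
    have h3 : (g (μ i) - 1) ^ 2 * μ i = χ i - 2 * (g (μ i) * μ i) + μ i := by
      rw [← hgχ]; ring
    rw [h3]
    by_cases h : μ i = 0
    · simp [χ, h]
    · have h4 : g (μ i) * μ i = Real.sqrt (μ i) := by
        simp only [g, h, if_false]
        rw [inv_mul_eq_div, Real.div_sqrt]
      have h5 : μ i ≤ Real.sqrt (μ i) := by
        refine Real.le_sqrt_of_sq_le ?_
        nlinarith [hμ0 i, hμ1 i]
      have h6 : χ i = 1 := by simp [χ, h]
      rw [h4, h6]
      linarith
  -- The rank of `U` is at least the number of nonzero eigenvalues, which is at least `∑ μ i = frob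
  -- T ^ 2` since each eigenvalue is at most `1`.
  · have h1 : LinearIndependent ℂ fun i : {i // μ i ≠ 0} =>
        (⟨U (b i), _, rfl⟩ : LinearMap.range U) := by
      refine LinearIndependent.of_comp (LinearMap.range U).subtype ?_
      refine linearIndependent_of_ne_zero_of_inner_eq_zero (𝕜 := ℂ) (fun i h => ?_) fun i k hik => ?_
      · have h2 := hUnorm i
        rw [show U (b i) = 0 from h] at h2
        simp [χ, i.2] at h2
      · have h2 := hUU i k
        rw [if_neg (fun h => hik (Subtype.ext h))] at h2
        exact h2
    have h2 := h1.fintype_card_le_finrank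
    have h3 := LinearMap.finrank_range_add_finrank_ker U
    have h4 : frob T ^ 2 ≤ Fintype.card {i // μ i ≠ 0} := by
      rw [frob_sq b]
      simp only [hnorm]
      refine (Finset.sum_le_sum fun i _ => hχμ i).trans (le_of_eq ?_)
      rw [Fintype.card_subtype, Finset.card_filter]
      push_cast
      refine Finset.sum_congr rfl fun i _ => ?_
      by_cases h : μ i = 0 <;> simp [χ, h]
    have h5 : (Fintype.card {i // μ i ≠ 0} : ℝ) ≤ finrank ℂ (LinearMap.range U) := by
      exact_mod_cast h2
    have h6 : (finrank ℂ (LinearMap.range U) : ℝ) + finrank ℂ (LinearMap.ker U)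
        = finrank ℂ V := by exact_mod_cast h3
    linarith

end Frobenius

/-! ### Approximate intertwining operators -/

namespace UnitaryRep

open Module

variable {H : Type*} [Group H]

theorem Intertwines.aeval {ρ : UnitaryRep H} {P : End ℂ ρ.space} (hP : ρ.Intertwines ρ P)
    (p : Polynomial ℂ) : ρ.Intertwines ρ (Polynomial.aeval P p : End ℂ ρ.space) := by
  intro h v
  induction p using Polynomial.induction_on' generalizing v with
  | add p q hp hq => rw [map_add, LinearMap.add_apply, LinearMap.add_apply, hp, hq, map_add]
  | monomial n a =>
    rw [Polynomial.aeval_monomial]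
    simp only [Module.algebraMap_end_eq_smul_id, End.mul_apply, LinearMap.smul_apply,
      LinearMap.id_apply, map_smul]
    congr 1
    induction n generalizing v with
    | zero => rfl
    | succ n ih => rw [pow_succ, End.mul_apply, End.mul_apply, hP, ih]

theorem exists_partial_isometry_intertwiner {ρ σ : UnitaryRep H} (T : ρ.space →ₗ[ℂ] σ.space)
    (hT : ρ.Intertwines σ T) (hT1 : ∀ v, ‖T v‖ ≤ ‖v‖) :
    ∃ U : ρ.space →ₗ[ℂ] σ.space, ρ.Intertwines σ U ∧
      (∀ v ∈ (LinearMap.ker U)ᗮ, ‖U v‖ = ‖v‖) ∧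
      frob (U - T) ^ 2 ≤ finrank ℂ ρ.space - frob T ^ 2 ∧
      (finrank ℂ (LinearMap.ker U) : ℝ) ≤ finrank ℂ ρ.space - frob T ^ 2 := by
  obtain ⟨p, U, hU, h1, h2, h3⟩ := exists_polynomial_partial_isometry T hT1
  refine ⟨U, fun h v => ?_, h1, h2, h3⟩
  rw [hU, LinearMap.comp_apply, LinearMap.comp_apply, ← hT]
  exact congrArg T (hT.adjoint_comp.aeval p h v)

/-- Averaging an approximate intertwining operator over a finite quotient. -/
theorem exists_intertwiner_near {N : Subgroup H} [N.Normal] [Fintype (H ⧸ N)]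
    (hN : ∀ (ρ : UnitaryRep H), ∀ h ∈ N, ρ.hom h = 1) {ρ σ : UnitaryRep H}
    (T₀ : ρ.space →ₗ[ℂ] σ.space) (hT₀ : ∀ v, ‖T₀ v‖ ≤ ‖v‖) :
    ∃ T : ρ.space →ₗ[ℂ] σ.space, ρ.Intertwines σ T ∧ (∀ v, ‖T v‖ ≤ ‖v‖) ∧
      frob (T - T₀) ≤ ∑ q : H ⧸ N, frob (unitaryToLin (σ.hom q.out) ∘ₗ T₀
        - T₀ ∘ₗ unitaryToLin (ρ.hom q.out)) := by
  let a : H ⧸ N →* (ρ.space ≃ₗᵢ[ℂ] ρ.space) := QuotientGroup.lift N ρ.hom (hN ρ)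
  let b : H ⧸ N →* (σ.space ≃ₗᵢ[ℂ] σ.space) := QuotientGroup.lift N σ.hom (hN σ)
  have ha : ∀ q : H ⧸ N, a q = ρ.hom q.out := fun q => by
    conv_lhs => rw [← QuotientGroup.out_eq' q]
    rfl
  have hb : ∀ q : H ⧸ N, b q = σ.hom q.out := fun q => by
    conv_lhs => rw [← QuotientGroup.out_eq' q]
    rfl
  let S : H ⧸ N → (ρ.space →ₗ[ℂ] σ.space) := fun q =>
    unitaryToLin (b q) ∘ₗ T₀ ∘ₗ unitaryToLin (a q⁻¹)
  have hS : ∀ q v, S q v = b q (T₀ (a q⁻¹ v)) := fun _ _ => rfl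
  let n : ℝ := Fintype.card (H ⧸ N)
  have hn : 1 ≤ n := by
    simp only [n]
    exact_mod_cast Fintype.card_pos
  have hnc : ‖(n : ℂ)⁻¹‖ = n⁻¹ := by
    rw [norm_inv, Complex.norm_real, Real.norm_of_nonneg (by linarith)]
  refine ⟨(n : ℂ)⁻¹ • ∑ q, S q, fun h v => ?_, fun v => ?_, ?_⟩
  · rw [LinearMap.smul_apply, LinearMap.smul_apply, map_smul, LinearMap.sum_apply,
      LinearMap.sum_apply, map_sum]
    congr 1
    refine (Fintype.sum_equiv (Equiv.mulLeft (h : H ⧸ N)) _ _ fun q => ?_).symm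
    change b h (b q (T₀ (a q⁻¹ v))) = b (h * q) (T₀ (a (h * q)⁻¹ (a h v)))
    have h1 : a (h * q)⁻¹ (a h v) = a q⁻¹ v := by
      change (a (h * q)⁻¹ * a h) v = _
      rw [← map_mul]
      congr 2
      group
    rw [h1, map_mul b]
    rfl
  · rw [LinearMap.smul_apply, norm_smul, hnc, LinearMap.sum_apply, inv_mul_le_iff₀ (by linarith)]
    refine (norm_sum_le _ _).trans ?_
    have h1 : ∀ q ∈ Finset.univ, ‖S q v‖ ≤ ‖v‖ := fun q _ => by
      rw [hS, LinearIsometryEquiv.norm_map]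
      exact (hT₀ _).trans (LinearIsometryEquiv.norm_map _ _).le
    refine (Finset.sum_le_sum h1).trans (le_of_eq ?_)
    rw [Finset.sum_const, nsmul_eq_mul]
    rfl
  · have h1 : (n : ℂ)⁻¹ • ∑ q, S q - T₀ = (n : ℂ)⁻¹ • ∑ q, (S q - T₀) := by
      rw [Finset.sum_sub_distrib, smul_sub, Finset.sum_const, Finset.card_univ,
        ← Nat.cast_smul_eq_nsmul ℂ, smul_smul]
      congr 1
      have : (n : ℂ)⁻¹ * (Fintype.card (H ⧸ N) : ℂ) = 1 := by
        simp only [n, Complex.ofReal_natCast]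
        exact inv_mul_cancel₀ (by exact_mod_cast Fintype.card_ne_zero)
      rw [this, one_smul]
    rw [h1, frob_smul, hnc]
    refine (mul_le_of_le_one_left (frob_nonneg _) (inv_le_one_of_one_le₀ hn)).trans
      ((frob_sum_le _ _).trans (Finset.sum_le_sum fun q _ => ?_))
    rw [← ha, ← hb]
    -- Each conjugate of `T₀` differs from `T₀` by the commutation error at `q` times a unitary.
    have h2 : S q - T₀ = (unitaryToLin (b q) ∘ₗ T₀ - T₀ ∘ₗ unitaryToLin (a q))
        ∘ₗ unitaryToLin (a q⁻¹) := by
      ext v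
      rw [LinearMap.sub_apply, hS]
      have h3 : a q (a q⁻¹ v) = v := by
        change (a q * a q⁻¹) v = v
        rw [← map_mul, mul_inv_cancel, map_one]
        rfl
      simp only [LinearMap.comp_apply, LinearMap.sub_apply]
      change _ = b q (T₀ (a q⁻¹ v)) - T₀ (a q (a q⁻¹ v))
      rw [h3]
    rw [h2]
    exact frob_comp_le _ _ fun v => (LinearIsometryEquiv.norm_map _ _).le

end UnitaryRep

/-! ### Comparing two isometric inclusions of one space -/

section Operators

open Module

variable {X V W : Type*} [NormedAddCommGroup V] [InnerProductSpace ℂ V] [FiniteDimensional ℂ V]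
  [NormedAddCommGroup W] [InnerProductSpace ℂ W] [FiniteDimensional ℂ W]
  [NormedAddCommGroup X] [InnerProductSpace ℂ X] [FiniteDimensional ℂ X]

/-- Insert `j₂ c j₁*` between the two terms. One difference is `D₂ j₁*`, the other is `j₂ c D₁* a`,
and all factors besides the defects are contractions. -/
theorem frob_comp_adjoint_sub_le (j₁ : X →ₗᵢ[ℂ] V) (j₂ : X →ₗᵢ[ℂ] W) (c : X ≃ₗᵢ[ℂ] X)
    (a : V ≃ₗᵢ[ℂ] V) (b : W ≃ₗᵢ[ℂ] W) :
    frob (unitaryToLin b ∘ₗ (j₂.toLinearMap ∘ₗ LinearMap.adjoint j₁.toLinearMap)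
      - (j₂.toLinearMap ∘ₗ LinearMap.adjoint j₁.toLinearMap) ∘ₗ unitaryToLin a)
      ≤ defect j₁ c a + defect j₂ c b := by
  set D₁ := unitaryToLin a ∘ₗ j₁.toLinearMap - j₁.toLinearMap ∘ₗ unitaryToLin c with hD₁
  set D₂ := unitaryToLin b ∘ₗ j₂.toLinearMap - j₂.toLinearMap ∘ₗ unitaryToLin c with hD₂
  have hadj : ∀ w, unitaryToLin c (LinearMap.adjoint D₁ (unitaryToLin a w))
      = unitaryToLin c (LinearMap.adjoint j₁.toLinearMap w)
        - LinearMap.adjoint j₁.toLinearMap (unitaryToLin a w) := by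
    intro w
    refine ext_inner_right ℂ fun x => ?_
    obtain ⟨y, rfl⟩ := c.surjective x
    have e1 : ∀ u v, inner ℂ (unitaryToLin c u) (c v) = inner ℂ u v := c.inner_map_map
    have e2 : inner ℂ (unitaryToLin a w) (a (j₁ y)) = inner ℂ w (j₁ y) := a.inner_map_map _ _
    rw [e1, inner_sub_left, e1, LinearMap.adjoint_inner_left, LinearMap.adjoint_inner_left,
      LinearMap.adjoint_inner_left]
    change inner ℂ (unitaryToLin a w) (a (j₁ y) - j₁ (c y)) = _
    rw [inner_sub_right, e2]
    rfl
  have hsum : unitaryToLin b ∘ₗ (j₂.toLinearMap ∘ₗ LinearMap.adjoint j₁.toLinearMap)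
      - (j₂.toLinearMap ∘ₗ LinearMap.adjoint j₁.toLinearMap) ∘ₗ unitaryToLin a
      = j₂.toLinearMap ∘ₗ (unitaryToLin c ∘ₗ (LinearMap.adjoint D₁ ∘ₗ unitaryToLin a))
        + D₂ ∘ₗ LinearMap.adjoint j₁.toLinearMap := by
    ext w
    simp only [LinearMap.add_apply, LinearMap.sub_apply, LinearMap.comp_apply, hadj, map_sub, hD₂]
    abel
  rw [hsum]
  refine (frob_add_le _ _).trans (add_le_add ?_ ?_)
  · refine (frob_le_frob _ (LinearMap.adjoint D₁ ∘ₗ unitaryToLin a) fun v => ?_).trans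
      ((frob_comp_le _ _ fun v => (a.norm_map v).le).trans (frob_adjoint _).le)
    exact ((j₂.norm_map _).trans (c.norm_map _)).le
  · exact frob_comp_le _ _ (norm_adjoint_apply_le _ fun v => (j₁.norm_map v).le)

/-- The inclusion of the first summand. -/
noncomputable def inlIsometry (V W : Type*) [NormedAddCommGroup V] [InnerProductSpace ℂ V]
    [NormedAddCommGroup W] [InnerProductSpace ℂ W] : V →ₗᵢ[ℂ] WithLp 2 (V × W) where
  toLinearMap := (WithLp.linearEquiv 2 ℂ (V × W)).symm.toLinearMap ∘ₗ LinearMap.inl ℂ V W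
  norm_map' v := WithLp.norm_toLp_fst 2 V W v

/-- An isometry that agrees with `U` on the complement of the kernel of `U` is close to `U`. -/
theorem frob_sub_le_of_eqOn {V W Z : Type*} [NormedAddCommGroup V] [InnerProductSpace ℂ V]
    [FiniteDimensional ℂ V] [NormedAddCommGroup W] [InnerProductSpace ℂ W]
    [NormedAddCommGroup Z] [InnerProductSpace ℂ Z] [FiniteDimensional ℂ Z] (U : V →ₗ[ℂ] W) (j : W →ₗᵢ[ℂ] Z) (E : V →ₗᵢ[ℂ] Z)
    (h : ∀ v ∈ (LinearMap.ker U)ᗮ, E v = j (U v)) :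
    frob (E.toLinearMap - j.toLinearMap ∘ₗ U) ^ 2 ≤ finrank ℂ (LinearMap.ker U) := by
  let ι : LinearMap.ker U →ₗᵢ[ℂ] V := (LinearMap.ker U).subtypeₗᵢ
  -- The difference vanishes on the complement of the kernel and equals `E` on the kernel, so it is
  -- `E` after the projection onto the kernel.
  have h1 : ∀ v, (E.toLinearMap - j.toLinearMap ∘ₗ U) v
      = E (ι (LinearMap.adjoint ι.toLinearMap v)) := by
    intro v
    have h2 : v - ι (LinearMap.adjoint ι.toLinearMap v) ∈ (LinearMap.ker U)ᗮ := by
      intro k hk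
      have h3 : inner ℂ k (ι (LinearMap.adjoint ι.toLinearMap v)) = inner ℂ k v := by
        refine (ι.inner_map_map ⟨k, hk⟩ _).trans ?_
        rw [LinearMap.adjoint_inner_right]
        rfl
      rw [inner_sub_right, h3, sub_self]
    have h4 := h _ h2
    have h5 : U (ι (LinearMap.adjoint ι.toLinearMap v)) = 0 :=
      (LinearMap.adjoint ι.toLinearMap v).2
    rw [map_sub, map_sub, h5, sub_zero] at h4
    change E v - j (U v) = _
    rw [← h4]
    abel
  have h6 : frob (E.toLinearMap - j.toLinearMap ∘ₗ U) = frob (LinearMap.adjoint ι.toLinearMap) := by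
    refine frob_eq_frob _ _ fun v => ?_
    rw [h1, E.norm_map, ι.norm_map]
  rw [h6, frob_adjoint, frob_sq_of_isometry _ ι.norm_map]

end Operators

/-! ### Hilbert-Schmidt stability of the double and the main theorem -/

section GroupDoubles

open Module

variable {G H : Type*} [Group G] [Group H]

/-- The pairs of multiplicities over `H` and dimensions of representations of `G`. -/
noncomputable def multMonoid (i : H →* G) : AddSubmonoid ((IrrHS H → ℤ) × ℕ) where
  carrier := {p | ∃ A : UnitaryRep G,
    p = (fun c => ((A.comap i).mult c : ℤ), finrank ℂ A.space)}
  zero_mem' := ⟨⟨EuclideanSpace ℂ (Fin 0), 1⟩, by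
    ext c
    · have : Subsingleton
          ((⟨EuclideanSpace ℂ (Fin 0), 1⟩ : UnitaryRep G).comap i).space :=
        inferInstanceAs (Subsingleton (EuclideanSpace ℂ (Fin 0)))
      simp only [UnitaryRep.mult_eq_zero_of_subsingleton]
      rfl
    · exact (finrank_zero_of_subsingleton (R := ℂ) (M := EuclideanSpace ℂ (Fin 0))).symm⟩
  add_mem' := by
    rintro _ _ ⟨A, rfl⟩ ⟨B, rfl⟩
    refine ⟨A.prod B, ?_⟩
    ext c
    · have := UnitaryRep.mult_prod (A.comap i) (B.comap i) c
      simp only [Prod.mk_add_mk, Pi.add_apply]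
      exact_mod_cast this.symm
    · change _ = finrank ℂ (WithLp 2 (A.space × B.space))
      rw [(WithLp.linearEquiv 2 ℂ (A.space × B.space)).finrank_eq, finrank_prod]
      rfl

/-- The representation transported along an isometric isomorphism. -/
noncomputable def conjHom {V : Type*} [NormedAddCommGroup V] [InnerProductSpace ℂ V]
    (σ : UnitaryRep G) (E : V ≃ₗᵢ[ℂ] σ.space) : G →* (V ≃ₗᵢ[ℂ] V) where
  toFun g := (E.trans (σ.hom g)).trans E.symm
  map_one' := by
    ext v
    rw [map_one]
    exact E.symm_apply_apply v
  map_mul' g h := by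
    ext v
    rw [map_mul]
    change E.symm (σ.hom g (σ.hom h (E v))) = E.symm (σ.hom g (E (E.symm (σ.hom h (E v)))))
    rw [E.apply_symm_apply]

/-- The quantitative core for unitaries. The set `F` consists of representatives of a finite
quotient through which all finite-dimensional representations of `H` factor. The number `κ` bounds
the dimension of the part of `ρ₁` on which the partial isometry over `H` vanishes. -/
theorem exists_groupDouble_rep (i : H →* G) [Finite (IrrHS H)] :
    ∃ (C : ℕ) (F : Finset H), ∀ (X : Type) [NormedAddCommGroup X] [InnerProductSpace ℂ X]
      [FiniteDimensional ℂ X] (φ : GroupDouble i → (X ≃ₗᵢ[ℂ] X)) (ρ₁ ρ₂ : UnitaryRep G)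
      (j₁ : X →ₗᵢ[ℂ] ρ₁.space) (j₂ : X →ₗᵢ[ℂ] ρ₂.space) (r₁ r₂ : G → ℝ) (D κ : ℝ),
      (∀ g, defect j₁ (φ (Monoid.PushoutI.of true g)) (ρ₁.hom g) = r₁ g) →
      (∀ g, defect j₂ (φ (Monoid.PushoutI.of false g)) (ρ₂.hom g) = r₂ g) →
      D = ∑ h ∈ F, (r₁ (i h) + r₂ (i h)) →
      κ = finrank ℂ ρ₁.space - finrank ℂ X + 2 * D * Real.sqrt (finrank ℂ X) →
      ∃ (ρ : UnitaryRep (GroupDouble i)) (j : X →ₗᵢ[ℂ] ρ.space),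
        (∀ g, defect j (φ (Monoid.PushoutI.of true g)) (ρ.hom (Monoid.PushoutI.of true g))
          ≤ r₁ g) ∧
        (∀ g, defect j (φ (Monoid.PushoutI.of false g)) (ρ.hom (Monoid.PushoutI.of false g))
          ≤ r₂ g + 2 * (2 * Real.sqrt κ + D)) ∧
        (finrank ℂ ρ.space : ℝ) ≤ finrank ℂ ρ₁.space
          + C * (2 * κ + (finrank ℂ ρ₂.space - finrank ℂ ρ₁.space)) := by
  classical
  have := Fintype.ofFinite (IrrHS H)
  obtain ⟨C, hC⟩ := exists_bounded_correction (multMonoid i)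
  obtain ⟨N, hNn, hNf, hN⟩ := UnitaryRep.exists_finite_quotient (H := H)
  have := Fintype.ofFinite (H ⧸ N)
  refine ⟨C * ∑ c : IrrHS H, finrank ℂ (UnitaryRep.rep c).space,
    Finset.univ.map ⟨fun q : H ⧸ N => q.out, Quotient.out_injective⟩,
    fun X _ _ _ φ ρ₁ ρ₂ j₁ j₂ r₁ r₂ D κ hr₁ hr₂ hD hκ => ?_⟩
  rw [Finset.sum_map] at hD
  have hbase : ∀ h, (Monoid.PushoutI.of true (i h) : GroupDouble i)
      = Monoid.PushoutI.of false (i h) := fun h => by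
    rw [Monoid.PushoutI.of_apply_eq_base (fun _ : Bool => i),
      Monoid.PushoutI.of_apply_eq_base (fun _ : Bool => i)]
  -- The partial isometry that identifies the two copies of `X`. It almost commutes with `H`, and
  -- averaging makes it commute exactly at cost `D`.
  let T₀ : ρ₁.space →ₗ[ℂ] ρ₂.space := j₂.toLinearMap ∘ₗ LinearMap.adjoint j₁.toLinearMap
  have hT₀ : ∀ v, ‖T₀ v‖ ≤ ‖v‖ := fun v =>
    (j₂.norm_map _).le.trans (norm_adjoint_apply_le _ (fun v => (j₁.norm_map v).le) v)
  obtain ⟨T, hT, hT1, hTT₀⟩ := UnitaryRep.exists_intertwiner_near hN (ρ := ρ₁.comap i)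
    (σ := ρ₂.comap i) T₀ hT₀
  have hTD : frob (T - T₀) ≤ D := by
    refine hTT₀.trans ?_
    rw [hD]
    refine Finset.sum_le_sum fun q _ => ?_
    refine (frob_comp_adjoint_sub_le j₁ j₂ (φ (Monoid.PushoutI.of true (i q.out))) _ _).trans ?_
    refine add_le_add (hr₁ _).le ?_
    rw [hbase]
    exact (hr₂ _).le
  obtain ⟨U, hU, hUiso, hUT, hUker⟩ := UnitaryRep.exists_partial_isometry_intertwiner T hT hT1
  have hfrobT₀ : frob T₀ = Real.sqrt (finrank ℂ X) := by
    have h1 : ∀ v, ‖j₁.toLinearMap v‖ = ‖v‖ := j₁.norm_map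
    rw [← frob_sq_of_isometry j₁.toLinearMap h1, Real.sqrt_sq (frob_nonneg _),
      ← frob_adjoint j₁.toLinearMap]
    exact frob_eq_frob T₀ _ fun v => j₂.norm_map _
  have hκT : finrank ℂ ρ₁.space - frob T ^ 2 ≤ κ := by
    have h1 : frob T₀ ≤ D + frob T := by
      have h2 := frob_sub_le_add T₀ T 0
      rw [sub_zero, sub_zero, frob_sub_comm] at h2
      linarith
    rw [hfrobT₀] at h1
    have h3 := Real.sq_sqrt (Nat.cast_nonneg (α := ℝ) (finrank ℂ X))
    have h4 := Real.sqrt_nonneg (finrank ℂ X : ℝ)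
    have h5 := frob_nonneg T
    have h6 : 0 ≤ D := (frob_nonneg _).trans hTD
    rw [hκ]
    -- If `√dim X ≤ D`, then `dim X - 2 D √dim X` is not positive and the bound is trivial;
    -- otherwise `√dim X - D ≤ frob T` may be squared.
    rcases le_total (Real.sqrt (finrank ℂ X)) D with h | h
    · nlinarith
    · nlinarith
  replace hUT := hUT.trans hκT
  replace hUker := hUker.trans hκT
  have hkinv : ∀ h, ∀ v ∈ LinearMap.ker U, (ρ₁.comap i).hom h v ∈ LinearMap.ker U := by
    intro h v hv
    rw [LinearMap.mem_ker] at hv ⊢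
    rw [hU, hv, map_zero]
  -- The common subrepresentation over `H`: the initial space of `U`, embedded by inclusion in `ρ₁`
  -- and by `U` in `ρ₂`.
  let χ : UnitaryRep H := (ρ₁.comap i).sub (LinearMap.ker U)ᗮ
    ((ρ₁.comap i).orthogonal_invariant hkinv)
  let J₁ : χ.space →ₗᵢ[ℂ] ρ₁.space := (LinearMap.ker U)ᗮ.subtypeₗᵢ
  have hJ₁ : χ.Intertwines (ρ₁.comap i) J₁ := fun h v => rfl
  let J₂ : χ.space →ₗᵢ[ℂ] ρ₂.space := ⟨U ∘ₗ J₁.toLinearMap, fun v => hUiso _ v.2⟩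
  have hJ₂ : χ.Intertwines (ρ₂.comap i) J₂ := fun h v => hU h v
  obtain ⟨_, ⟨A, rfl⟩, _, ⟨B, rfl⟩, hAB, hA, -⟩ := hC _ ⟨ρ₁, rfl⟩ _ ⟨ρ₂, rfl⟩
  have hmult : ((ρ₁.prod A).comap i).mult = ((ρ₂.prod B).comap i).mult := by
    ext c
    have h1 := UnitaryRep.mult_prod (ρ₁.comap i) (A.comap i) c
    have h2 := UnitaryRep.mult_prod (ρ₂.comap i) (B.comap i) c
    have h3 := congrFun hAB c
    simp only [Pi.add_apply] at h3
    refine h1.trans (Eq.trans ?_ h2.symm)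
    exact_mod_cast h3
  let I₁ := inlIsometry ρ₁.space A.space
  let I₂ := inlIsometry ρ₂.space B.space
  have hI₁ : ∀ g v, (ρ₁.prod A).hom g (I₁ v) = I₁ (ρ₁.hom g v) := fun g v =>
    congrArg (fun w => WithLp.toLp 2 (ρ₁.hom g v, w)) (map_zero (A.hom g))
  have hI₂ : ∀ g v, (ρ₂.prod B).hom g (I₂ v) = I₂ (ρ₂.hom g v) := fun g v =>
    congrArg (fun w => WithLp.toLp 2 (ρ₂.hom g v, w)) (map_zero (B.hom g))
  obtain ⟨E, hE, hEJ⟩ := UnitaryRep.exists_extension_of_mult_eq (χ := χ) hmult (I₁.comp J₁)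
    (fun h v => (hI₁ (i h) v).symm) (I₂.comp J₂)
    (fun h v => (congrArg I₂ (hJ₂ h v)).trans (hI₂ (i h) _).symm)
  have hEU : frob ((E.toLinearIsometry.comp I₁).toLinearMap - I₂.toLinearMap ∘ₗ U)
      ≤ Real.sqrt κ := by
    refine Real.le_sqrt_of_sq_le ((frob_sub_le_of_eqOn U I₂ (E.toLinearIsometry.comp I₁)
      fun v hv => ?_).trans hUker)
    exact hEJ ⟨v, hv⟩
  have hUT' : frob (U - T) ≤ Real.sqrt κ := Real.le_sqrt_of_sq_le hUT
  let j : X →ₗᵢ[ℂ] (ρ₁.prod A).space := I₁.comp j₁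
  let j' : X →ₗᵢ[ℂ] (ρ₂.prod B).space := I₂.comp j₂
  -- Pass from `E` to `U`, from `U` to `T` and from `T` to `T₀`, at cost `√κ`, `√κ` and `D`; on `j₁`
  -- the operator `T₀` is exactly `j₂`.
  have hEj : frob ((E.toLinearIsometry.comp j).toLinearMap - j'.toLinearMap)
      ≤ 2 * Real.sqrt κ + D := by
    have h1 : (E.toLinearIsometry.comp j).toLinearMap - j'.toLinearMap
        = ((E.toLinearIsometry.comp I₁).toLinearMap - I₂.toLinearMap ∘ₗ U) ∘ₗ j₁.toLinearMap
          + (I₂.toLinearMap ∘ₗ (U - T) ∘ₗ j₁.toLinearMap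
            + I₂.toLinearMap ∘ₗ (T - T₀) ∘ₗ j₁.toLinearMap) := by
      ext x
      have h2 : T₀ (j₁ x) = j₂ x := congrArg j₂ (adjoint_comp_isometry j₁ x)
      simp only [LinearMap.add_apply, LinearMap.sub_apply, LinearMap.comp_apply, map_sub]
      change E (I₁ (j₁ x)) - I₂ (j₂ x) = (E (I₁ (j₁ x)) - I₂ (U (j₁ x)))
        + ((I₂ (U (j₁ x)) - I₂ (T (j₁ x))) + (I₂ (T (j₁ x)) - I₂ (T₀ (j₁ x))))
      rw [h2]
      abel
    have hj₁ : ∀ v, ‖j₁.toLinearMap v‖ ≤ ‖v‖ := fun v => (j₁.norm_map v).le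
    rw [h1]
    have h2 := (frob_comp_le ((E.toLinearIsometry.comp I₁).toLinearMap - I₂.toLinearMap ∘ₗ U)
      j₁.toLinearMap hj₁).trans hEU
    have h3 := ((frob_le_frob (I₂.toLinearMap ∘ₗ (U - T) ∘ₗ j₁.toLinearMap)
      ((U - T) ∘ₗ j₁.toLinearMap) fun v => (I₂.norm_map _).le).trans
      (frob_comp_le (U - T) j₁.toLinearMap hj₁)).trans hUT'
    have h4 := ((frob_le_frob (I₂.toLinearMap ∘ₗ (T - T₀) ∘ₗ j₁.toLinearMap)
      ((T - T₀) ∘ₗ j₁.toLinearMap) fun v => (I₂.norm_map _).le).trans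
      (frob_comp_le (T - T₀) j₁.toLinearMap hj₁)).trans hTD
    have h5 := frob_add_le (((E.toLinearIsometry.comp I₁).toLinearMap - I₂.toLinearMap ∘ₗ U)
      ∘ₗ j₁.toLinearMap) (I₂.toLinearMap ∘ₗ (U - T) ∘ₗ j₁.toLinearMap
            + I₂.toLinearMap ∘ₗ (T - T₀) ∘ₗ j₁.toLinearMap)
    have h6 := frob_add_le (I₂.toLinearMap ∘ₗ (U - T) ∘ₗ j₁.toLinearMap)
      (I₂.toLinearMap ∘ₗ (T - T₀) ∘ₗ j₁.toLinearMap)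
    linarith
  let P₁ := (ρ₁.prod A).hom
  let P₂ : G →* ((ρ₁.prod A).space ≃ₗᵢ[ℂ] (ρ₁.prod A).space) := conjHom (ρ₂.prod B) E
  have hP₂ : ∀ g v, E (P₂ g v) = (ρ₂.prod B).hom g (E v) := fun g v => E.apply_symm_apply _
  let Ψ : GroupDouble i →* ((ρ₁.prod A).space ≃ₗᵢ[ℂ] (ρ₁.prod A).space) :=
    Monoid.PushoutI.lift (fun b => cond b P₁ P₂) (P₁.comp i) (by
      rintro (_ | _)
      · ext h v
        exact E.injective ((hP₂ (i h) v).trans (hE h v).symm)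
      · rfl)
  have hΨ₁ : ∀ g, Ψ (Monoid.PushoutI.of true g) = P₁ g := fun g =>
    Monoid.PushoutI.lift_of (fun b => cond b P₁ P₂) (P₁.comp i) _ g
  have hΨ₂ : ∀ g, Ψ (Monoid.PushoutI.of false g) = P₂ g := fun g =>
    Monoid.PushoutI.lift_of (fun b => cond b P₁ P₂) (P₁.comp i) _ g
  refine ⟨⟨(ρ₁.prod A).space, Ψ⟩, j, fun g => ?_, fun g => ?_, ?_⟩
  · rw [← hr₁, hΨ₁]
    refine frob_le_frob _ _ fun v => ?_
    change ‖(ρ₁.prod A).hom g (I₁ (j₁ v)) - I₁ (j₁ (φ (Monoid.PushoutI.of true g) v))‖ ≤ _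
    rw [hI₁, ← map_sub, I₁.norm_map]
    exact le_rfl
  · rw [← hr₂, hΨ₂]
    set c := φ (Monoid.PushoutI.of false g) with hc
    let R := (E.toLinearIsometry.comp j).toLinearMap - j'.toLinearMap
    let S := unitaryToLin ((ρ₂.prod B).hom g)
    -- Transporting along `E` replaces `E j` by `j'` once before and once after the group element
    -- acts, so the error `R` is paid twice.
    have h1 : E.toLinearIsometry.toLinearMap ∘ₗ
        (unitaryToLin (P₂ g) ∘ₗ j.toLinearMap - j.toLinearMap ∘ₗ unitaryToLin c)
        = S ∘ₗ R + (I₂.toLinearMap ∘ₗ (unitaryToLin (ρ₂.hom g) ∘ₗ j₂.toLinearMap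
          - j₂.toLinearMap ∘ₗ unitaryToLin c) + -(R ∘ₗ unitaryToLin c)) := by
      ext x
      change E (P₂ g (j x) - j (c x)) = (ρ₂.prod B).hom g (E (j x) - I₂ (j₂ x))
        + (I₂ (ρ₂.hom g (j₂ x) - j₂ (c x)) + -(E (j (c x)) - I₂ (j₂ (c x))))
      rw [map_sub, map_sub, map_sub, hP₂, hI₂]
      abel
    have h2 : defect j c (P₂ g) = frob (E.toLinearIsometry.toLinearMap ∘ₗ
        (unitaryToLin (P₂ g) ∘ₗ j.toLinearMap - j.toLinearMap ∘ₗ unitaryToLin c)) :=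
      frob_eq_frob _ _ fun v => (E.norm_map _).symm
    have h3 : frob (S ∘ₗ R) ≤ 2 * Real.sqrt κ + D :=
      (frob_le_frob _ R fun v => (((ρ₂.prod B).hom g).norm_map (R v)).le).trans hEj
    have h4 : frob (-(R ∘ₗ unitaryToLin c)) ≤ 2 * Real.sqrt κ + D := by
      rw [frob_neg]
      exact (frob_comp_le _ _ fun v => (c.norm_map v).le).trans hEj
    have h5 : frob (I₂.toLinearMap ∘ₗ (unitaryToLin (ρ₂.hom g) ∘ₗ j₂.toLinearMap
          - j₂.toLinearMap ∘ₗ unitaryToLin c)) ≤ defect j₂ c (ρ₂.hom g) :=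
      frob_le_frob _ _ fun v => (I₂.norm_map _).le
    change defect j c (P₂ g) ≤ _
    rw [h2, h1]
    have h6 := frob_add_le (S ∘ₗ R) (I₂.toLinearMap ∘ₗ (unitaryToLin (ρ₂.hom g) ∘ₗ j₂.toLinearMap
          - j₂.toLinearMap ∘ₗ unitaryToLin c) + -(R ∘ₗ unitaryToLin c))
    have h7 := frob_add_le (I₂.toLinearMap ∘ₗ (unitaryToLin (ρ₂.hom g) ∘ₗ j₂.toLinearMap
          - j₂.toLinearMap ∘ₗ unitaryToLin c)) (-(R ∘ₗ unitaryToLin c))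
    linarith
  · have h1 : finrank ℂ (WithLp 2 (ρ₁.space × A.space)) = finrank ℂ ρ₁.space + finrank ℂ A.space :=
      by rw [(WithLp.linearEquiv 2 ℂ (ρ₁.space × A.space)).finrank_eq, finrank_prod]
    change (finrank ℂ (WithLp 2 (ρ₁.space × A.space)) : ℝ) ≤ _
    rw [h1]
    push_cast
    have h2 := Finset.sum_le_sum fun c (_ : c ∈ Finset.univ) =>
      UnitaryRep.abs_mult_sub_le (χ := χ) (ρ := ρ₁.comap i) (σ := ρ₂.comap i) J₁ hJ₁ J₂ hJ₂ c
    rw [← Finset.sum_mul] at h2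
    have h3 := hA.trans (mul_le_mul_of_nonneg_left h2 (by positivity))
    have h4 : finrank ℂ (LinearMap.ker U) + finrank ℂ χ.space = finrank ℂ ρ₁.space :=
      (LinearMap.ker U).finrank_add_finrank_orthogonal
    have h5 : (finrank ℂ A.space : ℝ) ≤ C * ((∑ c : IrrHS H, (finrank ℂ (UnitaryRep.rep c).space : ℝ)) *
        ((finrank ℂ ρ₁.space - finrank ℂ χ.space)
          + (finrank ℂ ρ₂.space - finrank ℂ χ.space))) := by exact_mod_cast h3
    have h6 : (finrank ℂ (LinearMap.ker U) : ℝ) + finrank ℂ χ.space = finrank ℂ ρ₁.space := by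
      exact_mod_cast h4
    refine add_le_add_right (h5.trans ?_) _
    rw [← mul_assoc]
    refine mul_le_mul_of_nonneg_left ?_ (by positivity)
    linarith

/-- Defects are of order `o(√dim X)` and `κ` is `o(dim X)`, so every error vanishes after
normalisation. As for permutations, estimates on the two copies extend to the double through
products. -/
theorem FlexiblyHSStable.groupDouble (i : H →* G) [Finite (IrrHS H)]
    (hG : FlexiblyHSStable G) : FlexiblyHSStable (GroupDouble i) := by
  intro X _ _ _ _ φ hφ
  obtain ⟨C, F, hCF⟩ := exists_groupDouble_rep i
  have hrestrict : ∀ b : Bool, ∀ x y : G, Tendsto (fun n =>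
      hsDist (φ n (Monoid.PushoutI.of b x) * φ n (Monoid.PushoutI.of b y))
        (φ n (Monoid.PushoutI.of b (x * y)))) atTop (𝓝 0) := fun b x y => by
    rw [map_mul]
    exact hφ _ _
  obtain ⟨Y₁, _, _, _, j₁, ψ₁, hψ₁, hY₁⟩ := hG X (fun n g => φ n (Monoid.PushoutI.of true g))
    (hrestrict true)
  obtain ⟨Y₂, _, _, _, j₂, ψ₂, hψ₂, hY₂⟩ := hG X (fun n g => φ n (Monoid.PushoutI.of false g))
    (hrestrict false)
  let d : ℕ → ℝ := fun n => finrank ℂ (X n)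
  have hd : ∀ n, 0 < d n := fun n => by
    simp only [d]
    exact_mod_cast finrank_pos
  have hsd : ∀ n, 0 < Real.sqrt (d n) := fun n => Real.sqrt_pos.2 (hd n)
  let r₁ : ℕ → G → ℝ := fun n g => defect (j₁ n) (φ n (Monoid.PushoutI.of true g)) (ψ₁ n g)
  let r₂ : ℕ → G → ℝ := fun n g => defect (j₂ n) (φ n (Monoid.PushoutI.of false g)) (ψ₂ n g)
  let D : ℕ → ℝ := fun n => ∑ h ∈ F, (r₁ n (i h) + r₂ n (i h))
  let κ : ℕ → ℝ := fun n =>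
    finrank ℂ (Y₁ n) - finrank ℂ (X n) + 2 * D n * Real.sqrt (finrank ℂ (X n))
  choose ρ j h₁ h₂ hcard using fun n => hCF (X n) (φ n) ⟨Y₁ n, ψ₁ n⟩ ⟨Y₂ n, ψ₂ n⟩ (j₁ n) (j₂ n)
    (r₁ n) (r₂ n) (D n) (κ n) (fun _ => rfl) (fun _ => rfl) rfl rfl
  have hdefect : ∀ (Y : ℕ → Type) [∀ n, NormedAddCommGroup (Y n)]
      [∀ n, InnerProductSpace ℂ (Y n)] [∀ n, FiniteDimensional ℂ (Y n)]
      (j : ∀ n, X n →ₗᵢ[ℂ] Y n) (a : ∀ n, X n ≃ₗᵢ[ℂ] X n) (b : ∀ n, Y n ≃ₗᵢ[ℂ] Y n),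
      Tendsto (fun n => hsNorm (unitaryToLin (a n) - compression (j n) (b n))) atTop (𝓝 0) →
      Tendsto (fun n => defect (j n) (a n) (b n) / Real.sqrt (d n)) atTop (𝓝 0) := by
    intro Y _ _ _ j a b h
    -- The squared normalised defect is at most twice the normalised distance to the compression,
    -- which explains the square root.
    have h1 := (h.const_mul 2).sqrt
    rw [mul_zero, Real.sqrt_zero] at h1
    refine squeeze_zero (fun n => div_nonneg (frob_nonneg _) (hsd n).le) (fun n => ?_) h1
    refine Real.le_sqrt_of_sq_le ?_
    rw [div_pow, Real.sq_sqrt (hd n).le, div_le_iff₀ (hd n), hsNorm_eq]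
    refine (defect_sq_le _ _ _).trans (le_of_eq ?_)
    have h2 : d n = Real.sqrt (d n) * Real.sqrt (d n) := (Real.mul_self_sqrt (hd n).le).symm
    have h3 := (hsd n).ne'
    change 2 * (Real.sqrt (d n) * _) = 2 * (_ / Real.sqrt (d n)) * d n
    nth_rewrite 3 [h2]
    field_simp
  have hr₁ : ∀ g, Tendsto (fun n => r₁ n g / Real.sqrt (d n)) atTop (𝓝 0) := fun g =>
    hdefect Y₁ j₁ _ _ (hψ₁ g)
  have hr₂ : ∀ g, Tendsto (fun n => r₂ n g / Real.sqrt (d n)) atTop (𝓝 0) := fun g =>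
    hdefect Y₂ j₂ _ _ (hψ₂ g)
  have hD : Tendsto (fun n => D n / Real.sqrt (d n)) atTop (𝓝 0) := by
    have h := tendsto_finsetSum F fun h _ => (hr₁ (i h)).add (hr₂ (i h))
    simp only [add_zero, Finset.sum_const_zero] at h
    refine h.congr fun n => ?_
    simp only [D]
    rw [Finset.sum_div]
    exact Finset.sum_congr rfl fun _ _ => (add_div _ _ _).symm
  have hκ : Tendsto (fun n => κ n / d n) atTop (𝓝 0) := by
    have h := (hY₁.sub_const 1).add (hD.const_mul 2)
    simp only [sub_self, mul_zero, add_zero] at h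
    refine h.congr fun n => ?_
    have h2 : Real.sqrt (d n) * Real.sqrt (d n) = d n := Real.mul_self_sqrt (hd n).le
    have h3 := (hsd n).ne'
    have h4 : D n / Real.sqrt (d n) = D n * Real.sqrt (d n) / d n := by
      rw [div_eq_div_iff h3 (hd n).ne', mul_assoc, h2]
    rw [h4]
    change (finrank ℂ (Y₁ n) : ℝ) / d n - 1 + _
      = ((finrank ℂ (Y₁ n) : ℝ) - d n + 2 * D n * Real.sqrt (d n)) / d n
    have := (hd n).ne'
    field_simp
  have hsκ : Tendsto (fun n => Real.sqrt (κ n) / Real.sqrt (d n)) atTop (𝓝 0) := by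
    have h := hκ.sqrt
    rw [Real.sqrt_zero] at h
    exact h.congr fun n => Real.sqrt_div' _ (hd n).le
  refine ⟨fun n => (ρ n).space, fun n => (ρ n).normed, fun n => (ρ n).innerProd,
    fun n => (ρ n).finDim, j, fun n => (ρ n).hom, fun x => ?_, ?_⟩
  · have hnn : ∀ x, ∀ n, 0 ≤ defect (j n) (φ n x) ((ρ n).hom x) / Real.sqrt (d n) := fun x n =>
      div_nonneg (frob_nonneg _) (hsd n).le
    have hmain : Tendsto (fun n => defect (j n) (φ n x) ((ρ n).hom x) / Real.sqrt (d n)) atTop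
        (𝓝 0) := by
      induction x using groupDouble_induction with
      | h₁ g =>
        exact squeeze_zero (hnn _) (fun n => div_le_div_of_nonneg_right (h₁ n g) (hsd n).le) (hr₁ g)
      | h₂ g =>
        have h := (hr₂ g).add (((hsκ.const_mul 2).add hD).const_mul 2)
        simp only [mul_zero, add_zero] at h
        refine squeeze_zero (hnn _) (fun n => ?_) h
        refine (div_le_div_of_nonneg_right (h₂ n g) (hsd n).le).trans (le_of_eq ?_)
        ring
      | hm x y hx hy =>
        have h := (hφ x y).add (hx.add hy)
        simp only [add_zero] at h
        refine squeeze_zero (hnn _) (fun n => ?_) h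
        rw [hsDist, hsNorm_eq, ← add_div, ← add_div, map_mul]
        exact div_le_div_of_nonneg_right (defect_mul_le _ _ _ _ _ _) (hsd n).le
    exact squeeze_zero (fun n => Real.sqrt_nonneg _)
      (fun n => hsNorm_sub_compression_le _ _ _) hmain
  · have h := hY₁.add (((hκ.const_mul 2).add (hY₂.sub hY₁)).const_mul
      ((C : ℕ) : ℝ))
    simp only [sub_self, add_zero, mul_zero] at h
    refine tendsto_of_tendsto_of_tendsto_of_le_of_le tendsto_const_nhds h (fun n => ?_) fun n => ?_
    · change (1 : ℝ) ≤ _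
      rw [one_le_div (hd n)]
      exact Nat.cast_le.2 (LinearMap.finrank_le_finrank_of_injective
        (f := (j n).toLinearMap) (j n).injective)
    · refine (div_le_div_of_nonneg_right (hcard n) (hd n).le).trans (le_of_eq ?_)
      have := (hd n).ne'
      simp only [d]
      ring

theorem finite_of_rank_lt_aleph0 {ι : Type*} (h : Module.rank ℤ (ι →₀ ℤ) < Cardinal.aleph0) :
    Finite ι := by
  rw [rank_finsupp_self, Cardinal.lift_lt_aleph0] at h
  exact Cardinal.lt_aleph0_iff_finite.1 h

theorem rank_lt_aleph0_of_finite (ι : Type*) [Finite ι] :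
    Module.rank ℤ (ι →₀ ℤ) < Cardinal.aleph0 := by
  rw [rank_finsupp_self, Cardinal.lift_lt_aleph0]
  exact Cardinal.lt_aleph0_of_finite ι

end GroupDoubles

end FlexStab

theorem mainTheorem4 {G H : Type*} [Group G] [Group.FG G] [Group H]
    (i : H →* G) (hi : Function.Injective i) :
    (Module.rank ℤ (FlexStab.LambdaHS H) < Cardinal.aleph0 →
      FlexStab.FlexiblyHSStable G → FlexStab.FlexiblyHSStable (FlexStab.GroupDouble i)) ∧
    (Module.rank ℤ (FlexStab.LambdaP H) < Cardinal.aleph0 →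
      FlexStab.FlexiblyPStable G → FlexStab.FlexiblyPStable (FlexStab.GroupDouble i)) ∧
    (Finite H →
      Module.rank ℤ (FlexStab.LambdaHS H) < Cardinal.aleph0 ∧
      Module.rank ℤ (FlexStab.LambdaP H) < Cardinal.aleph0) := by
  refine ⟨fun h hG => ?_, fun h hG => ?_, fun _ => ⟨?_, ?_⟩⟩
  · have := FlexStab.finite_of_rank_lt_aleph0 h
    exact hG.groupDouble i
  · have := FlexStab.finite_of_rank_lt_aleph0 h
    exact hG.groupDouble i
  · have := FlexStab.finite_irrHS_of_finite (H := H)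
    exact FlexStab.rank_lt_aleph0_of_finite _
  · have := FlexStab.finite_irrP_of_finite (H := H)
    exact FlexStab.rank_lt_aleph0_of_finite _
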